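/- **Setting.** Let $n,\tau\ge 1$ and $d\ge 0$ be integers and $L,\sigma>0$. Each agent $i=1,\dots,n$ has a loss $F_i:\mathbb R^d\times\Xi_i\to\mathbb R$, differentiable in its first argument $x$ with $\nabla F_i(x;\xi)$ (the gradient in $x$) jointly measurable, and a probability distribution $P_i$ on $\Xi_i$ such that $f_i(x)=\mathbb E_{\xi_i\sim P_i}[F_i(x;\xi_i)]$ is finite for all $x$. Let $f=\frac1n\sum_{i=1}^n f_i$. *Smoothness.* Each $f_i$ is continuously differentiable with $\|\nabla f_i(x)-\nabla f_i(y)\|\le L\|x-y\|$ for all $x,y\in\mathbb R^d$, and $f$ is bounded below; $f^*=\inf f$. *Finite-time consensus.* $W^{(0)},\dots,W^{(\tau-1)}\in\mathbb R^{n\times n}$ are doubly stochastic and $W^{(\tau-1)}\cdots W^{(1)}W^{(0)}=\frac1n\mathbf 1\mathbf 1^{\mathsf T}$. *Algorithm (GT-FT).* Let $\alpha>0$. From initial points $x_i^{(0)}$ (possibly random, with finite second moments, and then independent of the samples $\xi_j^{(l)}$, $l\ge 0$, $1\le j\le n$, introduced below) and $g_i^{(0)}=\nabla F_i(x_i^{(0)};\xi_i^{(0)})$,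 iterate for $k\ge 0$, with $w_{ij}^{(k)}=W^{(k\bmod\tau)}_{ij}$, $$x_i^{(k+1)}=\sum_{j=1}^n w^{(k)}_{ij}\bigl(x_j^{(k)}-\alpha g_j^{(k)}\bigr),\qquad g_i^{(k+1)}=\sum_{j=1}^n w^{(k)}_{ij}g_j^{(k)}+\nabla F_i(x_i^{(k+1)};\xi_i^{(k+1)})-\nabla F_i(x_i^{(k)};\xi_i^{(k)}).$$ *Noise.* The samples $\xi_i^{(k)}$ ($k\ge0$, $1\le i\le n$) are mutually independent random variables with values in $\Xi_i$. With $\mathcal F^{(k)}$ the $\sigma$-algebra generated by $(x_i^{(l)})_{0\le l\le k,\,1\le i\le n}$, for all $k$ and $i$ the error $\nabla F_i(x_i^{(k)};\xi_i^{(k)})-\nabla f_i(x_i^{(k)})$ is square integrable, and almost surely $$\mathbb E[\nabla F_i(x_i^{(k)};\xi_i^{(k)})\mid\mathcal F^{(k)}]=\nabla f_i(x_i^{(k)}),\qquad \mathbb E[\|\nabla F_i(x_i^{(k)};\xi_i^{(k)})-\nabla f_i(x_i^{(k)})\|^2\mid\mathcal F^{(k)}]\le\sigma^2 .$$ Write $\bar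 x^{(k)}=\frac1n\sum_i x_i^{(k)}$ and $\overline{\nabla f}(\mathbf x^{(k)})=\frac1n\sum_i\nabla f_i(x_i^{(k)})$. **Theorem.** There are absolute constants $c,\gamma_2,\gamma_3>0$ such that, in every such setting with $0<\alpha\le\frac{1}{4\sqrt3\,\tau^2L}$, the random variables $\|\overline{\nabla f}(\mathbf x^{(k)})\|^2$ and $\|\nabla f(\bar x^{(k)})\|^2$ are integrable for all $k\ge0$, and for every constant $\gamma_1>0$ with $$\gamma_1\ \ge\ c\left(\frac{\mathbb E f(\bar x^{(0)})-f^*}{\alpha\tau^2L^2}+\frac{1}{\tau}\cdot\frac1n\sum_{i=1}^n\mathbb E\|x_i^{(0)}-\bar x^{(0)}\|^2+\alpha^2\tau\cdot\frac1n\sum_{i=1}^n\mathbb E\bigl\|\nabla f_i(x_i^{(0)})-\overline{\nabla f}(\mathbf x^{(0)})\bigr\|^2\right)$$ and every integer $T\ge\tau$, $$\frac1{T+1}\sum_{k=0}^{T}\Bigl(\mathbb E\|\overline{\nabla f}(\mathbf x^{(k)})\|^2+\mathbb E\|\nabla f(\bar x^{(k)})\|^2\Bigr)\le\frac{\gamma_1\tau^2L^2}{T}+\frac{\gamma_2\sigma^2}{\tau}+\frac{\gamma_3\sigma^2}{\tau^2n}.$$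 In particular $\gamma_1$ depends only on $L$, $\tau$, $\alpha$ and the initial data, not on $T$, $\sigma$ or the mixing matrices, so the bound does not depend on the connectivity of any individual graph in the sequence. -/

import Mathlib

open MeasureTheory ProbabilityTheory

noncomputable section

namespace GTFT

/-- The space `ℝ^d` with its Euclidean norm. -/
abbrev Vec (d : ℕ) : Type := EuclideanSpace ℝ (Fin d)

/-- The average `(1/n) ∑ i, v i` of one vector per agent. -/
def avg {n d : ℕ} (v : Fin n → Vec d) : Vec d := (n : ℝ)⁻¹ • ∑ i, v i

/-- The matrices `W 0, …, W (τ - 1)` are doubly stochastic and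
`W (τ - 1) * ⋯ * W 1 * W 0 = (1/n) 𝟙 𝟙ᵀ`. Only the entries `W l` with `l < τ` matter. -/
structure FiniteTimeConsensus {n : ℕ} (τ : ℕ) (W : ℕ → Matrix (Fin n) (Fin n) ℝ) : Prop where
  one_le : 1 ≤ τ
  doublyStochastic : ∀ l < τ, W l ∈ doublyStochastic ℝ (Fin n)
  prod_eq : ((List.range τ).reverse.map W).prod = Matrix.of fun _ _ => (n : ℝ)⁻¹

/-- The local objective `f_i(x) = E[F_i(x; ξ_i)]`, where `ξ_i` has law `P i`. -/
def localObj {n d : ℕ} {Ξ : Fin n → Type*} [∀ i, MeasurableSpace (Ξ i)]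
    (P : ∀ i, Measure (Ξ i)) (F : ∀ i, Vec d → Ξ i → ℝ) (i : Fin n) (x : Vec d) : ℝ :=
  ∫ z, F i x z ∂(P i)

/-- The global objective `f(x) = (1/n) ∑ i, f_i(x)`. -/
def globalObj {n d : ℕ} (f : Fin n → Vec d → ℝ) (x : Vec d) : ℝ :=
  (n : ℝ)⁻¹ * ∑ i, f i x

/-- The stochastic gradient `∇F_i(x; z)`, the gradient being taken in `x`. -/
def stochGrad {n d : ℕ} {Ξ : Fin n → Type*} (F : ∀ i, Vec d → Ξ i → ℝ)
    (i : Fin n) (x : Vec d) (z : Ξ i) : Vec d :=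
  gradient (fun y => F i y z) x

/-- `(W ⊗ I_d) v`: agent `i` receives `∑ j, W i j • v j`. -/
def mix {n d : ℕ} (W : Matrix (Fin n) (Fin n) ℝ) (v : Fin n → Vec d) : Fin n → Vec d :=
  fun i => ∑ j, W i j • v j

/-- The pair `(x^(k), g^(k))` of parameters and tracking variables of GT-FT, along one
realisation `z` of the samples: `g^(0) = ∇F(x^(0); z^(0))` and
`x^(k+1) = W^(k mod τ) (x^(k) - α g^(k))`,
`g^(k+1) = W^(k mod τ) g^(k) + ∇F(x^(k+1); z^(k+1)) - ∇F(x^(k); z^(k))`. -/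
def state {n d : ℕ} {Ξ : Fin n → Type*} (F : ∀ i, Vec d → Ξ i → ℝ) (τ : ℕ)
    (W : ℕ → Matrix (Fin n) (Fin n) ℝ) (α : ℝ) (x₀ : Fin n → Vec d)
    (z : ℕ → ∀ i, Ξ i) : ℕ → (Fin n → Vec d) × (Fin n → Vec d)
  | 0 => (x₀, fun i => stochGrad F i (x₀ i) (z 0 i))
  | k + 1 =>
    let s := state F τ W α x₀ z k
    let x' := mix (W (k % τ)) fun i => s.1 i - α • s.2 i
    (x', fun i => mix (W (k % τ)) s.2 i
      + stochGrad F i (x' i) (z (k + 1) i) - stochGrad F i (s.1 i) (z k i))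

/-- The random parameters `x_i^(k)` generated by GT-FT from the random initial points `x₀` and
the random samples `ξ`. -/
def iter {n d : ℕ} {Ξ : Fin n → Type*} {Ω : Type*} (F : ∀ i, Vec d → Ξ i → ℝ) (τ : ℕ)
    (W : ℕ → Matrix (Fin n) (Fin n) ℝ) (α : ℝ) (x₀ : Fin n → Ω → Vec d)
    (ξ : ℕ → ∀ i, Ω → Ξ i) (k : ℕ) (ω : Ω) : Fin n → Vec d :=
  (state F τ W α (fun i => x₀ i ω) (fun j i => ξ j i ω) k).1

/-- The `σ`-algebra generated by `x^(0), …, x^(k)`. -/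
abbrev history {n d : ℕ} {Ω : Type*} (x : ℕ → Ω → Fin n → Vec d) (k : ℕ) : MeasurableSpace Ω :=
  ⨆ j ∈ Set.Iic k, MeasurableSpace.comap (x j) inferInstance

/-- Every `f_i` is continuously differentiable with `L`-Lipschitz gradient, and `f` is bounded
below. -/
structure SmoothBelow {n d : ℕ} (f : Fin n → Vec d → ℝ) (L : ℝ) : Prop where
  contDiff : ∀ i, ContDiff ℝ 1 (f i)
  lipschitz : ∀ i x y, ‖gradient (f i) x - gradient (f i) y‖ ≤ L * ‖x - y‖
  bddBelow : BddBelow (Set.range (globalObj f))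

/-- The loss functions `F_i(·; z)` are differentiable, their stochastic gradients are jointly
measurable, and `f_i(x) = E[F_i(x; ξ_i)]` is a convergent expectation. -/
structure LossRegular {n d : ℕ} {Ξ : Fin n → Type*} [∀ i, MeasurableSpace (Ξ i)]
    (P : ∀ i, Measure (Ξ i)) (F : ∀ i, Vec d → Ξ i → ℝ) : Prop where
  differentiable : ∀ i z, Differentiable ℝ fun x => F i x z
  measurable_grad : ∀ i, Measurable fun p : Vec d × Ξ i => stochGrad F i p.1 p.2
  integrable : ∀ i x, Integrable (F i x) (P i)

/-- The initial points are random vectors with finite second moments, independent of the samples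
(deterministic initial points are a special case). -/
structure InitialCondition {n d : ℕ} {Ξ : Fin n → Type*} [∀ i, MeasurableSpace (Ξ i)]
    {Ω : Type*} [MeasurableSpace Ω] (μ : Measure Ω) (x₀ : Fin n → Ω → Vec d)
    (ξ : ℕ → ∀ i, Ω → Ξ i) : Prop where
  measurable : ∀ i, Measurable (x₀ i)
  memLp : ∀ i, MemLp (x₀ i) 2 μ
  indep : IndepFun (fun ω i => x₀ i ω) (fun ω (p : ℕ × Fin n) => ξ p.1 p.2 ω) μ

/-- The assumption on the stochastic gradients along the random sequence `x`: all samples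
`ξ_i^(k)` are mutually independent, and conditionally on `x^(0), …, x^(k)` the stochastic gradient
`∇F_i(x_i^(k); ξ_i^(k))` is unbiased for `∇f_i(x_i^(k))` with variance at most `σ²`.
(`sqIntegrable` makes the conditional variance a genuine, finite conditional expectation.) -/
structure NoiseAssumption {n d : ℕ} {Ξ : Fin n → Type*} [∀ i, MeasurableSpace (Ξ i)]
    {Ω : Type*} [MeasurableSpace Ω] (μ : Measure Ω) (F : ∀ i, Vec d → Ξ i → ℝ)
    (f : Fin n → Vec d → ℝ) (ξ : ℕ → ∀ i, Ω → Ξ i) (x : ℕ → Ω → Fin n → Vec d) (σ : ℝ) :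
    Prop where
  measurable : ∀ k i, Measurable (ξ k i)
  indep : iIndepFun (fun (p : ℕ × Fin n) => ξ p.1 p.2) μ
  sqIntegrable : ∀ k i, MemLp
    (fun ω => stochGrad F i (x k ω i) (ξ k i ω) - gradient (f i) (x k ω i)) 2 μ
  unbiased : ∀ k i,
    μ[fun ω => stochGrad F i (x k ω i) (ξ k i ω) | history x k]
      =ᵐ[μ] fun ω => gradient (f i) (x k ω i)
  variance : ∀ k i,
    μ[fun ω => ‖stochGrad F i (x k ω i) (ξ k i ω) - gradient (f i) (x k ω i)‖ ^ 2 | history x k]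
      ≤ᵐ[μ] fun _ => σ ^ 2

/-- `E f(x̄^(0)) - inf f`. -/
def initialGap {n d : ℕ} {Ω : Type*} [MeasurableSpace Ω] (μ : Measure Ω)
    (f : Fin n → Vec d → ℝ) (x₀ : Fin n → Ω → Vec d) : ℝ :=
  (∫ ω, globalObj f (avg fun i => x₀ i ω) ∂μ) - ⨅ y, globalObj f y

/-- `(1/n) ∑ i, E ‖x_i^(0) - x̄^(0)‖²`. -/
def initialDisagreement {n d : ℕ} {Ω : Type*} [MeasurableSpace Ω] (μ : Measure Ω)
    (x₀ : Fin n → Ω → Vec d) : ℝ :=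
  (n : ℝ)⁻¹ * ∑ i, ∫ ω, ‖x₀ i ω - avg fun j => x₀ j ω‖ ^ 2 ∂μ

/-- `(1/n) ∑ i, E ‖∇f_i(x_i^(0)) - (1/n) ∑ j, ∇f_j(x_j^(0))‖²`. -/
def initialGradSpread {n d : ℕ} {Ω : Type*} [MeasurableSpace Ω] (μ : Measure Ω)
    (f : Fin n → Vec d → ℝ) (x₀ : Fin n → Ω → Vec d) : ℝ :=
  (n : ℝ)⁻¹ * ∑ i, ∫ ω,
    ‖gradient (f i) (x₀ i ω) - avg fun j => gradient (f j) (x₀ j ω)‖ ^ 2 ∂μ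

end GTFT

end

/-!
Stack the agents into one vector. Its disagreement, the deviation from the mean, evolves under the
deflated matrices `W^(k) - (1/n) 𝟙 𝟙ᵀ`, and any `2τ` consecutive ones multiply to zero because they
contain a full period. Hence the disagreement of the parameters is a convolution of the increments
of the gradients with a kernel of finite memory. A Schur test bounds the contribution of the true
gradients, and the step size condition lets it be absorbed. For the noise one first sums by parts:
the errors at different times are orthogonal, and at most `2τ` of them, with coefficients of norm at
most `2τ`, enter at any given time, so their contribution has variance `O(τ³ n σ²)`. Meanwhile the
average takes gradient steps whose error is controlled by the disagreement, and the descent lemma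
telescopes.
-/

noncomputable section

namespace GTFT

/-! ### Products over windows of consecutive times -/

section Window

variable {M : Type*}

/-- The product `A (j + s - 1) * ⋯ * A j` of the `s` consecutive factors starting at time `j`,
later factors standing on the left. -/
def window [Monoid M] (A : ℕ → M) (j : ℕ) : ℕ → M
  | 0 => 1
  | s + 1 => A (j + s) * window A j s

theorem window_add [Monoid M] (A : ℕ → M) (j s t : ℕ) :
    window A j (s + t) = window A (j + s) t * window A j s := by
  induction t with
  | zero => simp only [Nat.add_zero, window, one_mul]
  | succ t ih => rw [← Nat.add_assoc, window, ih, window, Nat.add_assoc, mul_assoc]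

theorem prod_map_reverse_range [Monoid M] (A : ℕ → M) (s : ℕ) :
    ((List.range s).reverse.map A).prod = window A 0 s := by
  induction s with
  | zero => simp [window]
  | succ s ih =>
    rw [window, ← ih]
    simp [List.range_succ]

theorem map_window {N F : Type*} [Monoid M] [Monoid N] [FunLike F M N] [MonoidHomClass F M N]
    (φ : F) (A : ℕ → M) (j s : ℕ) : φ (window A j s) = window (fun k => φ (A k)) j s := by
  induction s with
  | zero => exact map_one φ
  | succ s ih => simp only [window, map_mul, ih]

theorem window_mod_eq [Monoid M] (A : ℕ → M) {τ s : ℕ} (hs : s ≤ τ) (t : ℕ) :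
    window (fun k => A (k % τ)) (t * τ) s = window A 0 s := by
  induction s with
  | zero => rfl
  | succ s ih =>
    have mod_eq : (t * τ + s) % τ = s := by
      rw [Nat.add_comm, Nat.add_mul_mod_self_right, Nat.mod_eq_of_lt hs]
    simp only [window, ih (Nat.le_of_succ_le hs), mod_eq, Nat.zero_add]

theorem mul_window_of_mul_eq [Monoid M] {A : ℕ → M} {e : M} (he : ∀ k, e * A k = e) (j s : ℕ) :
    e * window A j s = e := by
  induction s with
  | zero => exact mul_one e
  | succ s ih => rw [window, ← mul_assoc, he, ih]

theorem window_sub_of_absorbs [Ring M] {A : ℕ → M} {e : M} (he : IsIdempotentElem e)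
    (hleft : ∀ k, A k * e = e) (hright : ∀ k, e * A k = e) (j s : ℕ) :
    window (fun k => A k - e) j (s + 1) = window A j (s + 1) - e := by
  induction s with
  | zero => simp [window]
  | succ s ih =>
    calc window (fun k => A k - e) j (s + 1 + 1)
        = (A (j + (s + 1)) - e) * (window A j (s + 1) - e) := by rw [window, ih]
      _ = A (j + (s + 1)) * window A j (s + 1) - e := by
          rw [sub_mul, mul_sub, mul_sub, hleft, mul_window_of_mul_eq hright, he.eq, sub_self,
            sub_zero]

theorem window_eq_zero_of_le [MonoidWithZero M] {A : ℕ → M} {j s t r : ℕ}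
    (h : window A (j + s) t = 0) (hr : s + t ≤ r) : window A j r = 0 := by
  obtain ⟨q, rfl⟩ := Nat.exists_eq_add_of_le hr
  rw [window_add, window_add, h, zero_mul, mul_zero]

-- Any `2 τ` consecutive times contain a full period `t τ, …, t τ + τ - 1`.
theorem window_eq_zero_of_two_mul_le [MonoidWithZero M] {A : ℕ → M} {τ : ℕ} (hτ : 1 ≤ τ)
    (h : ∀ t, window A (t * τ) τ = 0) (j : ℕ) {r : ℕ} (hr : 2 * τ ≤ r) : window A j r = 0 := by
  have mod_lt : j % τ < τ := Nat.mod_lt j hτ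
  have next_period : j + (τ - j % τ) = (j / τ + 1) * τ := by
    have := Nat.div_add_mod j τ
    have : (j / τ + 1) * τ = τ * (j / τ) + τ := by ring
    omega
  exact window_eq_zero_of_le (s := τ - j % τ) (next_period ▸ h _) (by omega)

end Window

/-! ### The gradient tracking recursion -/

section Tracking

variable {H : Type*} [NormedAddCommGroup H] [NormedSpace ℝ H]

/-- The recursion of gradient tracking with mixing operators `A k` and step size `α`: the
parameters `y` follow the trackers `g`, which accumulate the increments of the gradient
estimates `s`. -/
structure IsTracking (A : ℕ → H →L[ℝ] H) (α : ℝ) (y g s : ℕ → H) : Prop where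
  param_succ : ∀ k, y (k + 1) = A k (y k - α • g k)
  tracker_zero : g 0 = s 0
  tracker_succ : ∀ k, g (k + 1) = A k (g k) + (s (k + 1) - s k)

/-- The operator by which the increment at time `j` of the gradient estimates enters the
parameters at time `m`: the increment is held by the tracker at each of the `m - j` steps from
`j` to `m`. It vanishes for `m ≤ j`. -/
def trackingKernel (A : ℕ → H →L[ℝ] H) (m j : ℕ) : H →L[ℝ] H :=
  ((m - j : ℕ) : ℝ) • window A j (m - j)

/-- The operator by which the gradient estimate at time `j` itself (rather than its increment)
enters the parameters at time `m`. -/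
def noiseKernel (A : ℕ → H →L[ℝ] H) (m j : ℕ) : H →L[ℝ] H :=
  trackingKernel A m j - trackingKernel A m (j + 1)

theorem trackingKernel_self (A : ℕ → H →L[ℝ] H) (m : ℕ) : trackingKernel A m m = 0 := by
  simp [trackingKernel]

theorem window_succ_sub_apply (A : ℕ → H →L[ℝ] H) {j m : ℕ} (hj : j ≤ m) (v : H) :
    window A j (m + 1 - j) v = A m (window A j (m - j) v) := by
  rw [Nat.succ_sub hj, window, Nat.add_sub_cancel' hj]
  rfl

theorem trackingKernel_succ_apply (A : ℕ → H →L[ℝ] H) {j m : ℕ} (hj : j ≤ m) (v : H) :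
    trackingKernel A (m + 1) j v = A m (trackingKernel A m j v + window A j (m - j) v) := by
  have cast_eq : ((m + 1 - j : ℕ) : ℝ) = ((m - j : ℕ) : ℝ) + 1 := by
    rw [Nat.succ_sub hj, Nat.cast_succ]
  simp only [trackingKernel, smul_apply, window_succ_sub_apply A hj, map_add, map_smul,
    cast_eq, add_apply, add_smul, one_smul]

namespace IsTracking

variable {A : ℕ → H →L[ℝ] H} {α : ℝ} {y g s : ℕ → H}

theorem map {H' : Type*} [NormedAddCommGroup H'] [NormedSpace ℝ H'] {B : ℕ → H' →L[ℝ] H'}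
    (h : IsTracking A α y g s) (C : H →L[ℝ] H') (hC : ∀ k v, C (A k v) = B k (C v)) :
    IsTracking B α (fun k => C (y k)) (fun k => C (g k)) (fun k => C (s k)) where
  param_succ k := by simp only [h.param_succ, hC, map_sub, map_smul]
  tracker_zero := by rw [h.tracker_zero]
  tracker_succ k := by simp only [h.tracker_succ, hC, map_sub, map_add]

theorem tracker_eq (h : IsTracking A α y g s) (k : ℕ) :
    g k = window A 0 k (s 0)
      + ∑ j ∈ Finset.range (k + 1), window A j (k - j) (s j - s (j - 1)) := by
  induction k with
  | zero => simp [window, h.tracker_zero]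
  | succ k ih =>
    have propagate : ∀ j ∈ Finset.range (k + 1), window A j (k + 1 - j) (s j - s (j - 1))
        = A k (window A j (k - j) (s j - s (j - 1))) := fun j hj =>
      window_succ_sub_apply A (Nat.lt_succ_iff.1 (Finset.mem_range.1 hj)) _
    have propagate_zero : window A 0 (k + 1) (s 0) = A k (window A 0 k (s 0)) :=
      window_succ_sub_apply A k.zero_le _
    rw [h.tracker_succ, ih, Finset.sum_range_succ _ (k + 1), Finset.sum_congr rfl propagate,
      propagate_zero, map_add, map_sum]
    simp [window, add_assoc]

theorem param_eq (h : IsTracking A α y g s) (m : ℕ) :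
    y m = window A 0 m (y 0) - α • (trackingKernel A m 0 (s 0)
      + ∑ j ∈ Finset.range m, trackingKernel A m j (s j - s (j - 1))) := by
  induction m with
  | zero => simp [window, trackingKernel]
  | succ m ih =>
    have propagate : ∀ j ∈ Finset.range (m + 1),
        trackingKernel A (m + 1) j (s j - s (j - 1))
          = A m (trackingKernel A m j (s j - s (j - 1)) + window A j (m - j) (s j - s (j - 1))) :=
      fun j hj => trackingKernel_succ_apply A (Nat.lt_succ_iff.1 (Finset.mem_range.1 hj)) _
    have propagate_zero : window A 0 (m + 1) (y 0) = A m (window A 0 m (y 0)) :=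
      window_succ_sub_apply A m.zero_le _
    rw [Finset.sum_congr rfl propagate, ← map_sum, trackingKernel_succ_apply A m.zero_le,
      ← map_add, propagate_zero, ← map_smul, ← map_sub, h.param_succ, ih, h.tracker_eq,
      Finset.sum_add_distrib, Finset.sum_range_succ (fun j => trackingKernel A m j _) m,
      trackingKernel_self, Nat.sub_zero]
    congr 1
    simp only [smul_add, zero_apply, add_zero]
    abel

end IsTracking

theorem apply_zero_add_sum_apply_sub_pred (C : ℕ → H →L[ℝ] H) (u : ℕ → H) (m : ℕ) :
    C 0 (u 0) + ∑ j ∈ Finset.range m, C j (u j - u (j - 1))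
      = ∑ j ∈ Finset.range m, (C j - C (j + 1)) (u j) + C m (u (m - 1)) := by
  induction m with
  | zero => simp
  | succ m ih =>
    rw [Finset.sum_range_succ, ← add_assoc, ih, Finset.sum_range_succ]
    simp only [map_sub, sub_apply, Nat.add_sub_cancel]
    abel

theorem IsTracking.param_eq_initial_sub_noise_sub_drift {A : ℕ → H →L[ℝ] H} {α : ℝ}
    {y g s : ℕ → H} (h : IsTracking A α y g s) (a : ℕ → H) (m : ℕ) :
    y m = window A 0 m (y 0) - α • trackingKernel A m 0 (a 0)
      - α • ∑ j ∈ Finset.range m, noiseKernel A m j (s j - a j)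
      - α • ∑ j ∈ Finset.range m, trackingKernel A m j (a j - a (j - 1)) := by
  have noise_by_parts := apply_zero_add_sum_apply_sub_pred (trackingKernel A m)
    (fun j => s j - a j) m
  simp only [trackingKernel_self, zero_apply, add_zero] at noise_by_parts
  simp only [noiseKernel]
  rw [h.param_eq m, ← noise_by_parts]
  have split : ∀ j, trackingKernel A m j (s j - s (j - 1))
      = trackingKernel A m j (s j - a j - (s (j - 1) - a (j - 1)))
        + trackingKernel A m j (a j - a (j - 1)) := fun j => by
    rw [← map_add]
    congr 1
    abel
  simp only [split, Finset.sum_add_distrib, map_sub (trackingKernel A m 0), smul_add, smul_sub]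
  abel

end Tracking
/-! ### Summation of finite-memory kernels -/

section FiniteMemory

theorem sum_comp_le_sum_range {ι : Type*} {κ : ℕ → ℝ} {M : ℕ} (hκ : ∀ s, 0 ≤ κ s)
    (hM : ∀ s, κ s ≠ 0 → s < M) (S : Finset ι) (φ : ι → ℕ)
    (hφ : Set.InjOn φ {i ∈ S | κ (φ i) ≠ 0}) :
    ∑ i ∈ S, κ (φ i) ≤ ∑ s ∈ Finset.range M, κ s := by
  classical
  rw [← Finset.sum_filter_ne_zero, ← Finset.sum_image (f := κ) (by simpa using hφ)]
  refine Finset.sum_le_sum_of_subset_of_nonneg (fun s hs => ?_) fun s _ _ => hκ s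
  obtain ⟨i, hi, rfl⟩ := Finset.mem_image.1 hs
  exact Finset.mem_range.2 (hM _ (Finset.mem_filter.1 hi).2)

theorem sum_sq_sum_mul_le_of_sum_le {ι ι' : Type*} {S : Finset ι} {S' : Finset ι'}
    {k : ι → ι' → ℝ} {R C : ℝ} (hk : ∀ i j, 0 ≤ k i j) (hR : 0 ≤ R)
    (hrow : ∀ i ∈ S, ∑ j ∈ S', k i j ≤ R) (hcol : ∀ j ∈ S', ∑ i ∈ S, k i j ≤ C) (a : ι' → ℝ) :
    ∑ i ∈ S, (∑ j ∈ S', k i j * a j) ^ 2 ≤ R * C * ∑ j ∈ S', a j ^ 2 := by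
  have hka : ∀ i j, 0 ≤ k i j * a j ^ 2 := fun i j => mul_nonneg (hk i j) (sq_nonneg _)
  calc ∑ i ∈ S, (∑ j ∈ S', k i j * a j) ^ 2
      ≤ ∑ i ∈ S, R * ∑ j ∈ S', k i j * a j ^ 2 := by
        refine Finset.sum_le_sum fun i hi => ?_
        have cauchy_schwarz := Finset.sum_sq_le_sum_mul_sum_of_sq_le_mul S'
          (r := fun j => k i j * a j) (fun j _ => hk i j) (fun j _ => hka i j)
          (fun j _ => le_of_eq (by ring))
        exact cauchy_schwarz.trans
          (mul_le_mul_of_nonneg_right (hrow i hi) (Finset.sum_nonneg fun j _ => hka i j))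
    _ = R * ∑ j ∈ S', (∑ i ∈ S, k i j) * a j ^ 2 := by
        simp only [← Finset.mul_sum, Finset.sum_mul]
        rw [Finset.sum_comm]
    _ ≤ R * ∑ j ∈ S', C * a j ^ 2 := by
        gcongr with j hj
        exact hcol j hj
    _ = R * C * ∑ j ∈ S', a j ^ 2 := by rw [← Finset.mul_sum, mul_assoc]

theorem sum_range_two_mul_le (τ : ℕ) :
    ∑ s ∈ Finset.range (2 * τ), (s : ℝ) ≤ 2 * (τ : ℝ) ^ 2 := by
  induction τ with
  | zero => simp
  | succ τ ih =>
    rw [Nat.mul_succ, Finset.sum_range_succ, Finset.sum_range_succ]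
    push_cast
    linarith

theorem sum_range_succ_sq_le (N : ℕ) :
    ∑ s ∈ Finset.range (N + 1), (s : ℝ) ^ 2 ≤ (N : ℝ) ^ 3 := by
  induction N with
  | zero => simp
  | succ N ih =>
    rw [Finset.sum_range_succ]
    push_cast
    have : (0 : ℝ) ≤ N := N.cast_nonneg
    nlinarith

theorem injOn_sub_left_of_ne_zero {m : ℕ} {S : Set ℕ} (hS : ∀ j ∈ S, m - j ≠ 0) :
    Set.InjOn (fun j => m - j) S := fun i hi j hj hij => by
  have := hS i hi
  have := hS j hj
  simp only at hij
  omega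

theorem injOn_sub_right_of_ne_zero {j : ℕ} {S : Set ℕ} (hS : ∀ m ∈ S, m - j ≠ 0) :
    Set.InjOn (fun m => m - j) S := fun i hi m hm him => by
  have := hS i hi
  have := hS m hm
  simp only at him
  omega

theorem norm_add_sq_le_two {H : Type*} [SeminormedAddCommGroup H] (u v : H) :
    ‖u + v‖ ^ 2 ≤ 2 * (‖u‖ ^ 2 + ‖v‖ ^ 2) :=
  (pow_le_pow_left₀ (norm_nonneg _) (norm_add_le u v) 2).trans add_sq_le

theorem norm_sub_sq_le_two {H : Type*} [SeminormedAddCommGroup H] (u v : H) :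
    ‖u - v‖ ^ 2 ≤ 2 * (‖u‖ ^ 2 + ‖v‖ ^ 2) := by
  simpa only [sub_eq_add_neg, norm_neg] using norm_add_sq_le_two u (-v)

variable {H : Type*} [NormedAddCommGroup H] [NormedSpace ℝ H]

/-- A sequence of operators of norm at most `1` whose product over each period
`t τ, …, t τ + τ - 1` vanishes. For gradient tracking these are the operators `W k - (1/n) 𝟙 𝟙ᵀ`
moving the disagreement of the agents. -/
structure FiniteTimeContraction (τ : ℕ) (A : ℕ → H →L[ℝ] H) : Prop where
  one_le : 1 ≤ τ
  norm_le_one : ∀ k, ‖A k‖ ≤ 1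
  window_period : ∀ t, window A (t * τ) τ = 0

namespace FiniteTimeContraction

variable {τ : ℕ} {A : ℕ → H →L[ℝ] H}

theorem norm_window_le_one (hA : FiniteTimeContraction τ A) (j s : ℕ) : ‖window A j s‖ ≤ 1 := by
  induction s with
  | zero => exact ContinuousLinearMap.norm_id_le
  | succ s ih =>
    exact (norm_mul_le _ _).trans (mul_le_one₀ (hA.norm_le_one _) (norm_nonneg _) ih)

theorem window_eq_zero (hA : FiniteTimeContraction τ A) (j : ℕ) {r : ℕ} (hr : 2 * τ ≤ r) :
    window A j r = 0 :=
  window_eq_zero_of_two_mul_le hA.one_le hA.window_period j hr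

theorem window_zero_eq_zero (hA : FiniteTimeContraction τ A) {r : ℕ} (hr : τ ≤ r) :
    window A 0 r = 0 :=
  window_eq_zero_of_le (s := 0) (t := τ) (by simpa using hA.window_period 0) (by omega)

theorem norm_trackingKernel_le (hA : FiniteTimeContraction τ A) (m j : ℕ) :
    ‖trackingKernel A m j‖ ≤ ((m - j : ℕ) : ℝ) := by
  rw [trackingKernel, norm_smul, Real.norm_natCast]
  exact mul_le_of_le_one_right (Nat.cast_nonneg _) (hA.norm_window_le_one _ _)

theorem trackingKernel_eq_zero (hA : FiniteTimeContraction τ A) {m j : ℕ} (h : 2 * τ ≤ m - j) :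
    trackingKernel A m j = 0 := by
  rw [trackingKernel, hA.window_eq_zero j h, smul_zero]

theorem norm_noiseKernel_le (hA : FiniteTimeContraction τ A) (m j : ℕ) :
    ‖noiseKernel A m j‖ ≤ 2 * ((m - j : ℕ) : ℝ) := by
  have cast_le : ((m - (j + 1) : ℕ) : ℝ) ≤ ((m - j : ℕ) : ℝ) := by
    exact_mod_cast Nat.sub_le_sub_left j.le_succ m
  calc ‖noiseKernel A m j‖ ≤ ‖trackingKernel A m j‖ + ‖trackingKernel A m (j + 1)‖ :=
        norm_sub_le _ _
    _ ≤ 2 * ((m - j : ℕ) : ℝ) := by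
        linarith [hA.norm_trackingKernel_le m j, hA.norm_trackingKernel_le m (j + 1)]

theorem noiseKernel_eq_zero (hA : FiniteTimeContraction τ A) {m j : ℕ}
    (h : 2 * τ + 1 ≤ m - j) : noiseKernel A m j = 0 := by
  rw [noiseKernel, hA.trackingKernel_eq_zero (by omega), hA.trackingKernel_eq_zero (by omega),
    sub_zero]

theorem sum_norm_noiseKernel_sq_le (hA : FiniteTimeContraction τ A) (m : ℕ) :
    ∑ j ∈ Finset.range m, ‖noiseKernel A m j‖ ^ 2 ≤ 32 * (τ : ℝ) ^ 3 := by
  let κ : ℕ → ℝ := fun s => if s < 2 * τ + 1 then 4 * (s : ℝ) ^ 2 else 0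
  have norm_sq_le : ∀ j, ‖noiseKernel A m j‖ ^ 2 ≤ κ (m - j) := fun j => by
    by_cases h : m - j < 2 * τ + 1
    · simp only [κ, if_pos h]
      calc ‖noiseKernel A m j‖ ^ 2 ≤ (2 * ((m - j : ℕ) : ℝ)) ^ 2 :=
            pow_le_pow_left₀ (norm_nonneg _) (hA.norm_noiseKernel_le m j) 2
        _ = 4 * ((m - j : ℕ) : ℝ) ^ 2 := by ring
    · simp only [κ, if_neg h, hA.noiseKernel_eq_zero (not_lt.1 h)]
      simp
  calc ∑ j ∈ Finset.range m, ‖noiseKernel A m j‖ ^ 2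
      ≤ ∑ j ∈ Finset.range m, κ (m - j) := Finset.sum_le_sum fun j _ => norm_sq_le j
    _ ≤ ∑ s ∈ Finset.range (2 * τ + 1), κ s := by
        refine sum_comp_le_sum_range (fun s => by simp only [κ]; positivity)
          (fun s hs => by by_contra h; exact hs (if_neg h)) _ _ (injOn_sub_left_of_ne_zero ?_)
        rintro j ⟨hj, -⟩
        simpa [Nat.sub_eq_zero_iff_le] using hj
    _ = 4 * ∑ s ∈ Finset.range (2 * τ + 1), (s : ℝ) ^ 2 := by
        rw [Finset.mul_sum]
        exact Finset.sum_congr rfl fun s hs => if_pos (Finset.mem_range.1 hs)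
    _ ≤ 4 * ((2 * τ : ℕ) : ℝ) ^ 3 := by gcongr; exact sum_range_succ_sq_le _
    _ = 32 * (τ : ℝ) ^ 3 := by push_cast; ring

theorem sum_norm_sum_trackingKernel_sq_le (hA : FiniteTimeContraction τ A) (w : ℕ → H) (N : ℕ) :
    ∑ m ∈ Finset.range N, ‖∑ j ∈ Finset.range m, trackingKernel A m j (w j)‖ ^ 2
      ≤ 4 * (τ : ℝ) ^ 4 * ∑ j ∈ Finset.range N, ‖w j‖ ^ 2 := by
  let κ : ℕ → ℝ := fun s => if s < 2 * τ then (s : ℝ) else 0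
  have hκ : ∀ s, 0 ≤ κ s := fun s => by simp only [κ]; positivity
  have κ_supp : ∀ {s}, κ s ≠ 0 → s ≠ 0 := by
    rintro _ hs rfl
    simp [κ] at hs
  have norm_le : ∀ m j, ‖trackingKernel A m j‖ ≤ κ (m - j) := fun m j => by
    by_cases h : m - j < 2 * τ
    · simpa only [κ, if_pos h] using hA.norm_trackingKernel_le m j
    · simp [κ, h, hA.trackingKernel_eq_zero (not_lt.1 h)]
  have sum_κ_le : ∑ s ∈ Finset.range (2 * τ), κ s ≤ 2 * (τ : ℝ) ^ 2 :=
    (Finset.sum_congr rfl fun s hs => if_pos (Finset.mem_range.1 hs)).trans_le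
      (sum_range_two_mul_le τ)
  have sum_κ_comp_le : ∀ φ : ℕ → ℕ, Set.InjOn φ {i ∈ Finset.range N | κ (φ i) ≠ 0} →
      ∑ i ∈ Finset.range N, κ (φ i) ≤ 2 * (τ : ℝ) ^ 2 := fun φ hφ =>
    (sum_comp_le_sum_range hκ (fun s hs => by by_contra h; exact hs (if_neg h)) _ φ hφ).trans
      sum_κ_le
  have schur := sum_sq_sum_mul_le_of_sum_le (S := Finset.range N) (S' := Finset.range N)
    (k := fun m j => κ (m - j)) (R := 2 * (τ : ℝ) ^ 2) (C := 2 * (τ : ℝ) ^ 2)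
    (fun m j => hκ _) (by positivity)
    (fun m _ => sum_κ_comp_le _ (injOn_sub_left_of_ne_zero fun j hj => κ_supp hj.2))
    (fun j _ => sum_κ_comp_le _ (injOn_sub_right_of_ne_zero fun m hm => κ_supp hm.2))
    (fun j => ‖w j‖)
  calc ∑ m ∈ Finset.range N, ‖∑ j ∈ Finset.range m, trackingKernel A m j (w j)‖ ^ 2
      ≤ ∑ m ∈ Finset.range N, (∑ j ∈ Finset.range N, κ (m - j) * ‖w j‖) ^ 2 := by
        gcongr with m hm
        calc ‖∑ j ∈ Finset.range m, trackingKernel A m j (w j)‖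
            ≤ ∑ j ∈ Finset.range m, κ (m - j) * ‖w j‖ :=
              norm_sum_le_of_le _ fun j _ => ContinuousLinearMap.le_of_opNorm_le _ (norm_le m j) _
          _ ≤ ∑ j ∈ Finset.range N, κ (m - j) * ‖w j‖ :=
              Finset.sum_le_sum_of_subset_of_nonneg
                (Finset.range_subset_range.2 (Finset.mem_range.1 hm).le)
                fun j _ _ => mul_nonneg (hκ _) (norm_nonneg _)
    _ ≤ 2 * (τ : ℝ) ^ 2 * (2 * (τ : ℝ) ^ 2) * ∑ j ∈ Finset.range N, ‖w j‖ ^ 2 := schur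
    _ = 4 * (τ : ℝ) ^ 4 * ∑ j ∈ Finset.range N, ‖w j‖ ^ 2 := by ring

theorem sum_norm_initial_sq_le (hA : FiniteTimeContraction τ A) (α : ℝ) (u v : H) (N : ℕ) :
    ∑ m ∈ Finset.range N, ‖window A 0 m u - α • trackingKernel A m 0 v‖ ^ 2
      ≤ 2 * (τ * ‖u‖ ^ 2 + α ^ 2 * (τ : ℝ) ^ 3 * ‖v‖ ^ 2) := by
  let κ : ℕ → ℝ := fun m => if m < τ then 2 * (‖u‖ ^ 2 + α ^ 2 * (τ : ℝ) ^ 2 * ‖v‖ ^ 2) else 0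
  have norm_sq_le : ∀ m, ‖window A 0 m u - α • trackingKernel A m 0 v‖ ^ 2 ≤ κ m := fun m => by
    by_cases hm : m < τ
    · simp only [κ, if_pos hm]
      have window_le : ‖window A 0 m u‖ ≤ ‖u‖ := by
        simpa using ContinuousLinearMap.le_of_opNorm_le _ (hA.norm_window_le_one 0 m) u
      have kernel_le : ‖trackingKernel A m 0 v‖ ≤ τ * ‖v‖ :=
        ContinuousLinearMap.le_of_opNorm_le _ ((hA.norm_trackingKernel_le m 0).trans
          (by exact_mod_cast hm.le)) v
      calc ‖window A 0 m u - α • trackingKernel A m 0 v‖ ^ 2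
          ≤ 2 * (‖window A 0 m u‖ ^ 2 + α ^ 2 * ‖trackingKernel A m 0 v‖ ^ 2) := by
            simpa only [norm_smul, mul_pow, Real.norm_eq_abs, sq_abs] using
              norm_sub_sq_le_two (window A 0 m u) (α • trackingKernel A m 0 v)
        _ ≤ 2 * (‖u‖ ^ 2 + α ^ 2 * (τ * ‖v‖) ^ 2) := by gcongr
        _ = 2 * (‖u‖ ^ 2 + α ^ 2 * (τ : ℝ) ^ 2 * ‖v‖ ^ 2) := by ring
    · simp [κ, hm, trackingKernel, hA.window_zero_eq_zero (not_lt.1 hm)]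
  calc ∑ m ∈ Finset.range N, ‖window A 0 m u - α • trackingKernel A m 0 v‖ ^ 2
      ≤ ∑ m ∈ Finset.range N, κ m := Finset.sum_le_sum fun m _ => norm_sq_le m
    _ ≤ ∑ m ∈ Finset.range τ, κ m :=
        sum_comp_le_sum_range (fun s => by simp only [κ]; positivity)
          (fun s hs => by by_contra h; exact hs (if_neg h)) _ id (Set.injOn_id _)
    _ = 2 * (τ * ‖u‖ ^ 2 + α ^ 2 * (τ : ℝ) ^ 3 * ‖v‖ ^ 2) := by
        rw [Finset.sum_congr rfl fun m hm => if_pos (Finset.mem_range.1 hm), Finset.sum_const,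
          Finset.card_range, nsmul_eq_mul]
        ring

end FiniteTimeContraction

end FiniteMemory
/-! ### Disagreement along one realisation -/

section Disagreement

theorem sum_norm_sub_pred_sq_le {H : Type*} [SeminormedAddCommGroup H] {L : ℝ} {y a : ℕ → H}
    {p : ℕ → ℝ} (hp : ∀ k, 0 ≤ p k)
    (ha : ∀ k, ‖a (k + 1) - a k‖ ^ 2 ≤ L ^ 2 * (2 * (‖y (k + 1)‖ ^ 2 + ‖y k‖ ^ 2) + p k))
    (N : ℕ) :
    ∑ j ∈ Finset.range N, ‖a j - a (j - 1)‖ ^ 2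
      ≤ L ^ 2 * (4 * ∑ k ∈ Finset.range N, ‖y k‖ ^ 2 + ∑ k ∈ Finset.range N, p k) := by
  rcases N with - | N
  · simp
  have shifted : ∑ k ∈ Finset.range N, ‖y (k + 1)‖ ^ 2
      ≤ ∑ k ∈ Finset.range (N + 1), ‖y k‖ ^ 2 := by
    rw [Finset.sum_range_succ']
    exact le_add_of_nonneg_right (sq_nonneg _)
  have truncated : ∀ {u : ℕ → ℝ}, (∀ k, 0 ≤ u k) →
      ∑ k ∈ Finset.range N, u k ≤ ∑ k ∈ Finset.range (N + 1), u k := fun {u} hu => by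
    rw [Finset.sum_range_succ]
    exact le_add_of_nonneg_right (hu N)
  calc ∑ j ∈ Finset.range (N + 1), ‖a j - a (j - 1)‖ ^ 2
      = ∑ k ∈ Finset.range N, ‖a (k + 1) - a k‖ ^ 2 := by simp [Finset.sum_range_succ']
    _ ≤ ∑ k ∈ Finset.range N, L ^ 2 * (2 * (‖y (k + 1)‖ ^ 2 + ‖y k‖ ^ 2) + p k) :=
        Finset.sum_le_sum fun k _ => ha k
    _ = L ^ 2 * (2 * (∑ k ∈ Finset.range N, ‖y (k + 1)‖ ^ 2 + ∑ k ∈ Finset.range N, ‖y k‖ ^ 2)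
          + ∑ k ∈ Finset.range N, p k) := by
        simp only [← Finset.mul_sum, Finset.sum_add_distrib]
    _ ≤ _ := by
        refine mul_le_mul_of_nonneg_left ?_ (sq_nonneg L)
        linarith [truncated hp, truncated fun k => sq_nonneg ‖y k‖]

variable {H : Type*} [NormedAddCommGroup H] [NormedSpace ℝ H]

theorem IsTracking.norm_param_sq_le {A : ℕ → H →L[ℝ] H} {α : ℝ} {y g s : ℕ → H}
    (h : IsTracking A α y g s) (a : ℕ → H) (m : ℕ) :
    ‖y m‖ ^ 2 ≤ 4 * ‖window A 0 m (y 0) - α • trackingKernel A m 0 (a 0)‖ ^ 2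
      + 4 * α ^ 2 * ‖∑ j ∈ Finset.range m, noiseKernel A m j (s j - a j)‖ ^ 2
      + 2 * α ^ 2 * ‖∑ j ∈ Finset.range m, trackingKernel A m j (a j - a (j - 1))‖ ^ 2 := by
  set initial := window A 0 m (y 0) - α • trackingKernel A m 0 (a 0)
  set noise := ∑ j ∈ Finset.range m, noiseKernel A m j (s j - a j)
  set drift := ∑ j ∈ Finset.range m, trackingKernel A m j (a j - a (j - 1))
  have outer := norm_sub_sq_le_two (initial - α • noise) (α • drift)
  have inner := norm_sub_sq_le_two initial (α • noise)
  rw [h.param_eq_initial_sub_noise_sub_drift a m]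
  simp only [norm_smul, mul_pow, Real.norm_eq_abs, sq_abs] at outer inner
  linarith

theorem IsTracking.sum_norm_param_sq_le {A : ℕ → H →L[ℝ] H} {τ : ℕ} {α L : ℝ}
    {y g s a : ℕ → H} {q : ℕ → ℝ} (h : IsTracking A α y g s) (hA : FiniteTimeContraction τ A)
    (hstep : 48 * (α * L * (τ : ℝ) ^ 2) ^ 2 ≤ 1) (hq : ∀ k, 0 ≤ q k)
    (ha : ∀ k, ‖a (k + 1) - a k‖ ^ 2
      ≤ L ^ 2 * (2 * (‖y (k + 1)‖ ^ 2 + ‖y k‖ ^ 2) + α ^ 2 * q k)) (N : ℕ) :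
    ∑ m ∈ Finset.range N, ‖y m‖ ^ 2
      ≤ α ^ 2 / 2 * ∑ m ∈ Finset.range N, q m
        + 24 * (τ * ‖y 0‖ ^ 2 + α ^ 2 * (τ : ℝ) ^ 3 * ‖a 0‖ ^ 2)
        + 12 * α ^ 2 * ∑ m ∈ Finset.range N,
            ‖∑ j ∈ Finset.range m, noiseKernel A m j (s j - a j)‖ ^ 2 := by
  have initial_le := hA.sum_norm_initial_sq_le α (y 0) (a 0) N
  have drift_le := hA.sum_norm_sum_trackingKernel_sq_le (fun j => a j - a (j - 1)) N
  have increments_le :=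
    sum_norm_sub_pred_sq_le (fun k => mul_nonneg (sq_nonneg α) (hq k)) ha N
  have summed := Finset.sum_le_sum fun m (_ : m ∈ Finset.range N) => h.norm_param_sq_le a m
  simp only [Finset.sum_add_distrib, ← Finset.mul_sum] at increments_le summed
  set Y := ∑ m ∈ Finset.range N, ‖y m‖ ^ 2
  set Q := ∑ m ∈ Finset.range N, q m
  have Q_nonneg : 0 ≤ Q := Finset.sum_nonneg fun _ _ => hq _
  have drift_absorbed : 2 * α ^ 2 * ∑ m ∈ Finset.range N,
      ‖∑ j ∈ Finset.range m, trackingKernel A m j (a j - a (j - 1))‖ ^ 2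
        ≤ 1 / 6 * (4 * Y + α ^ 2 * Q) := by
    calc _ ≤ 2 * α ^ 2 * (4 * (τ : ℝ) ^ 4 * (L ^ 2 * (4 * Y + α ^ 2 * Q))) := by
          gcongr
          exact drift_le.trans (by gcongr)
      _ = 8 * (α * L * (τ : ℝ) ^ 2) ^ 2 * (4 * Y + α ^ 2 * Q) := by ring
      _ ≤ 1 / 6 * (4 * Y + α ^ 2 * Q) := by
          have Y_nonneg : 0 ≤ Y := Finset.sum_nonneg fun _ _ => sq_nonneg _
          exact mul_le_mul_of_nonneg_right (by linarith)
            (add_nonneg (mul_nonneg zero_le_four Y_nonneg) (mul_nonneg (sq_nonneg α) Q_nonneg))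
  linarith

end Disagreement

/-! ### Mixing of stacked vectors -/

section Mixing

variable {ι : Type*} [Fintype ι] {E : Type*} [NormedAddCommGroup E] [NormedSpace ℝ E]

/-- One vector of `E` per agent, with the norm `‖v‖² = ∑ i, ‖v i‖²`. -/
abbrev Stack (ι E : Type*) : Type _ := PiLp 2 fun _ : ι => E

/-- The mean of the vectors of the agents. -/
def mean : Stack ι E →L[ℝ] E :=
  (Fintype.card ι : ℝ)⁻¹ • ∑ i, PiLp.proj 2 (fun _ : ι => E) i

/-- The stack giving the same vector to every agent. -/
def replicate (ι : Type*) [Fintype ι] : E →L[ℝ] Stack ι E :=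
  ((PiLp.continuousLinearEquiv 2 ℝ fun _ : ι => E).symm : (ι → E) →L[ℝ] Stack ι E).comp
    (ContinuousLinearMap.pi fun _ => ContinuousLinearMap.id ℝ E)

theorem mean_apply (v : Stack ι E) : mean v = (Fintype.card ι : ℝ)⁻¹ • ∑ i, v i := by
  simp [mean]

theorem replicate_apply (x : E) (i : ι) : replicate ι x i = x := by
  simp [replicate]

theorem norm_replicate_sq (x : E) : ‖replicate ι x‖ ^ 2 = Fintype.card ι * ‖x‖ ^ 2 := by
  simp [PiLp.norm_sq_eq_of_L2, replicate_apply]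

/-- The disagreement of a stack: what remains after removing the mean from each vector. -/
def center : Stack ι E →L[ℝ] Stack ι E :=
  ContinuousLinearMap.id ℝ (Stack ι E) - (replicate ι).comp mean

theorem center_apply (v : Stack ι E) : center v = v - replicate ι (mean v) := rfl

section InnerProductSpace

variable [Nonempty ι] {E : Type*} [NormedAddCommGroup E] [InnerProductSpace ℝ E]

theorem inner_replicate (v : Stack ι E) (x : E) :
    inner ℝ v (replicate ι x) = Fintype.card ι * inner ℝ (mean v) x := by
  simp only [PiLp.inner_apply, replicate_apply, mean_apply, ← sum_inner, inner_smul_left]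
  simp

theorem norm_sq_eq_norm_center_sq_add (v : Stack ι E) :
    ‖v‖ ^ 2 = ‖center v‖ ^ 2 + Fintype.card ι * ‖mean v‖ ^ 2 := by
  rw [center_apply, norm_sub_sq_real, inner_replicate, norm_replicate_sq,
    real_inner_self_eq_norm_sq]
  ring

theorem norm_center_le (v : Stack ι E) : ‖center v‖ ≤ ‖v‖ := by
  refine le_of_sq_le_sq ?_ (norm_nonneg _)
  rw [norm_sq_eq_norm_center_sq_add v]
  exact le_add_of_nonneg_right (by positivity)

theorem card_mul_norm_mean_sq_le (v : Stack ι E) :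
    Fintype.card ι * ‖mean v‖ ^ 2 ≤ ‖v‖ ^ 2 := by
  rw [norm_sq_eq_norm_center_sq_add v]
  exact le_add_of_nonneg_left (sq_nonneg _)

end InnerProductSpace

/-- The matrix `(1/n) 𝟙 𝟙ᵀ` of exact averaging. -/
def avgMatrix (ι : Type*) [Fintype ι] : Matrix ι ι ℝ :=
  Matrix.of fun _ _ => (Fintype.card ι : ℝ)⁻¹

theorem isIdempotentElem_avgMatrix [Nonempty ι] : IsIdempotentElem (avgMatrix ι) := by
  ext i j
  simp [Matrix.mul_apply, avgMatrix]

variable [DecidableEq ι]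

/-- The operator `W ⊗ id` on stacks, as a ring homomorphism in `W`. -/
def mixL : Matrix ι ι ℝ →+* (Stack ι E →L[ℝ] Stack ι E) where
  toFun W := ((PiLp.continuousLinearEquiv 2 ℝ fun _ : ι => E).symm : (ι → E) →L[ℝ] Stack ι E).comp
    (ContinuousLinearMap.pi fun i => ∑ j, W i j • PiLp.proj 2 (fun _ : ι => E) j)
  map_one' := by ext v i; simp [Matrix.one_apply]
  map_mul' U V := by
    ext v i
    simpa [Matrix.mul_apply, Finset.sum_smul, Finset.smul_sum, mul_smul] using Finset.sum_comm
  map_zero' := by ext v i; simp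
  map_add' U V := by ext v i; simp [add_smul, Finset.sum_add_distrib]

theorem mixL_apply (W : Matrix ι ι ℝ) (v : Stack ι E) (i : ι) :
    mixL W v i = ∑ j, W i j • v j := by
  simp [mixL]

theorem mixL_avgMatrix (v : Stack ι E) : mixL (avgMatrix ι) v = replicate ι (mean v) := by
  ext i
  simp [mixL_apply, replicate_apply, mean_apply, avgMatrix, Finset.smul_sum]

theorem mixL_one_sub_avgMatrix :
    mixL (1 - avgMatrix ι) = (center : Stack ι E →L[ℝ] Stack ι E) := by
  ext1 v
  rw [map_sub, map_one, sub_apply, mixL_avgMatrix, center_apply]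
  rfl

theorem mul_avgMatrix {W : Matrix ι ι ℝ} (hW : W ∈ doublyStochastic ℝ ι) :
    W * avgMatrix ι = avgMatrix ι := by
  ext i j
  simp [Matrix.mul_apply, avgMatrix, ← Finset.sum_mul, sum_row_of_mem_doublyStochastic hW]

theorem avgMatrix_mul {W : Matrix ι ι ℝ} (hW : W ∈ doublyStochastic ℝ ι) :
    avgMatrix ι * W = avgMatrix ι := by
  ext i j
  simp [Matrix.mul_apply, avgMatrix, ← Finset.mul_sum, sum_col_of_mem_doublyStochastic hW]

theorem mean_mixL {W : Matrix ι ι ℝ} (hW : W ∈ doublyStochastic ℝ ι) (v : Stack ι E) :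
    mean (mixL W v) = mean v := by
  simp only [mean_apply, mixL_apply]
  rw [Finset.sum_comm]
  simp only [← Finset.sum_smul, sum_col_of_mem_doublyStochastic hW, one_smul]

theorem norm_mixL_le_one {W : Matrix ι ι ℝ} (hW : W ∈ doublyStochastic ℝ ι) :
    ‖(mixL W : Stack ι E →L[ℝ] Stack ι E)‖ ≤ 1 := by
  refine ContinuousLinearMap.opNorm_le_bound _ zero_le_one fun v => ?_
  rw [one_mul]
  refine le_of_sq_le_sq ?_ (norm_nonneg _)
  calc ‖mixL W v‖ ^ 2 = ∑ i, ‖∑ j, W i j • v j‖ ^ 2 := by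
        simp only [PiLp.norm_sq_eq_of_L2, mixL_apply]
    _ ≤ ∑ i, ∑ j, W i j * ‖v j‖ ^ 2 := Finset.sum_le_sum fun i _ =>
        ((convexOn_norm convex_univ).pow (fun v _ => norm_nonneg v) 2).map_sum_le
          (fun j _ => nonneg_of_mem_doublyStochastic hW) (sum_row_of_mem_doublyStochastic hW i)
          fun j _ => Set.mem_univ (v j)
    _ = ‖v‖ ^ 2 := by
        rw [Finset.sum_comm, PiLp.norm_sq_eq_of_L2]
        simp only [← Finset.sum_mul, sum_col_of_mem_doublyStochastic hW, one_mul]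

theorem center_mixL [Nonempty ι] {W : Matrix ι ι ℝ} (hW : W ∈ doublyStochastic ℝ ι)
    (v : Stack ι E) : center (mixL W v) = mixL (W - avgMatrix ι) (center v) := by
  have intertwine : (1 - avgMatrix ι) * W = (W - avgMatrix ι) * (1 - avgMatrix ι) := by
    rw [sub_mul, sub_mul, mul_sub, mul_sub, avgMatrix_mul hW, mul_avgMatrix hW,
      isIdempotentElem_avgMatrix.eq, one_mul, mul_one, mul_one, sub_self, sub_zero]
  rw [← mixL_one_sub_avgMatrix, ← mul_apply_eq_comp, ← map_mul, intertwine, map_mul]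
  rfl

variable {E : Type*} [NormedAddCommGroup E] [InnerProductSpace ℝ E]

theorem norm_mixL_sub_avgMatrix_le_one [Nonempty ι] {W : Matrix ι ι ℝ}
    (hW : W ∈ doublyStochastic ℝ ι) :
    ‖(mixL (W - avgMatrix ι) : Stack ι E →L[ℝ] Stack ι E)‖ ≤ 1 := by
  have factor : W - avgMatrix ι = W * (1 - avgMatrix ι) := by
    rw [mul_sub, mul_one, mul_avgMatrix hW]
  have norm_center : ‖(center : Stack ι E →L[ℝ] Stack ι E)‖ ≤ 1 :=
    ContinuousLinearMap.opNorm_le_bound _ zero_le_one fun v => by simpa using norm_center_le v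
  rw [factor, map_mul, mixL_one_sub_avgMatrix]
  exact (ContinuousLinearMap.opNorm_comp_le _ _).trans
    (mul_le_one₀ (norm_mixL_le_one hW) (norm_nonneg _) norm_center)

/-- The operator by which mixing with `W k` moves the disagreement of a stack. -/
def disagreementOp (W : ℕ → Matrix ι ι ℝ) (k : ℕ) : Stack ι E →L[ℝ] Stack ι E :=
  mixL (W k - avgMatrix ι)

/-- A sequence of doubly stochastic matrices with the product `(1/n) 𝟙 𝟙ᵀ` over each period
`t τ, …, t τ + τ - 1`. -/
structure PeriodicConsensus (τ : ℕ) (W : ℕ → Matrix ι ι ℝ) : Prop where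
  one_le : 1 ≤ τ
  mem_doublyStochastic : ∀ k, W k ∈ doublyStochastic ℝ ι
  window_period : ∀ t, window W (t * τ) τ = avgMatrix ι

theorem PeriodicConsensus.finiteTimeContraction [Nonempty ι] {τ : ℕ} {W : ℕ → Matrix ι ι ℝ}
    (hW : PeriodicConsensus τ W) :
    FiniteTimeContraction τ (disagreementOp W : ℕ → Stack ι E →L[ℝ] Stack ι E) where
  one_le := hW.one_le
  norm_le_one k := norm_mixL_sub_avgMatrix_le_one (hW.mem_doublyStochastic k)
  window_period t := by
    obtain ⟨s, rfl⟩ := Nat.exists_eq_add_of_le' hW.one_le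
    change window (fun k => mixL (W k - avgMatrix ι)) _ _ = 0
    rw [← map_window mixL, window_sub_of_absorbs isIdempotentElem_avgMatrix
      (fun k => mul_avgMatrix (hW.mem_doublyStochastic k))
      (fun k => avgMatrix_mul (hW.mem_doublyStochastic k)), hW.window_period, sub_self, map_zero]

theorem FiniteTimeConsensus.periodicConsensus {n τ : ℕ} {W : ℕ → Matrix (Fin n) (Fin n) ℝ}
    (hW : FiniteTimeConsensus τ W) : PeriodicConsensus τ fun k => W (k % τ) where
  one_le := hW.one_le
  mem_doublyStochastic k := hW.doublyStochastic _ (Nat.mod_lt k hW.one_le)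
  window_period t := by
    rw [window_mod_eq W le_rfl, ← prod_map_reverse_range, hW.prod_eq]
    simp [avgMatrix]

namespace IsTracking

variable {W : ℕ → Matrix ι ι ℝ} {α : ℝ} {x g s : ℕ → Stack ι E}

theorem map_center [Nonempty ι] (h : IsTracking (fun k => mixL (W k)) α x g s)
    (hW : ∀ k, W k ∈ doublyStochastic ℝ ι) :
    IsTracking (disagreementOp W) α (fun k => center (x k))
      (fun k => center (g k)) (fun k => center (s k)) :=
  h.map center fun k => center_mixL (hW k)

theorem mean_param_succ (h : IsTracking (fun k => mixL (W k)) α x g s)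
    (hW : ∀ k, W k ∈ doublyStochastic ℝ ι) (k : ℕ) :
    mean (x (k + 1)) = mean (x k) - α • mean (s k) := by
  have tracking : IsTracking (fun _ => 1) α (fun k => mean (x k)) (fun k => mean (g k))
      (fun k => mean (s k)) := h.map mean fun k v => mean_mixL (hW k) v
  have mean_tracker : ∀ k, mean (g k) = mean (s k) := fun k => by
    induction k with
    | zero => exact tracking.tracker_zero
    | succ k ih => simpa [ih] using tracking.tracker_succ k
  simpa [mean_tracker k] using tracking.param_succ k

theorem sum_norm_center_sq_le [Nonempty ι] {τ : ℕ} {L : ℝ} {a : ℕ → Stack ι E}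
    (h : IsTracking (fun k => mixL (W k)) α x g s) (hW : PeriodicConsensus τ W)
    (hstep : 48 * (α * L * (τ : ℝ) ^ 2) ^ 2 ≤ 1)
    (ha : ∀ k, ‖a (k + 1) - a k‖ ≤ L * ‖x (k + 1) - x k‖) (N : ℕ) :
    ∑ m ∈ Finset.range N, ‖center (x m)‖ ^ 2
      ≤ α ^ 2 / 2 * ∑ m ∈ Finset.range N, Fintype.card ι * ‖mean (s m)‖ ^ 2
        + 24 * (τ * ‖center (x 0)‖ ^ 2 + α ^ 2 * (τ : ℝ) ^ 3 * ‖center (a 0)‖ ^ 2)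
        + 12 * α ^ 2 * ∑ m ∈ Finset.range N, ‖∑ j ∈ Finset.range m,
            noiseKernel (disagreementOp W) m j (center (s j - a j))‖ ^ 2 := by
  have center_sub : ∀ u v : Stack ι E, center (u - v) = center u - center v := map_sub center
  simp only [center_sub]
  refine (h.map_center hW.mem_doublyStochastic).sum_norm_param_sq_le
    (a := fun k => center (a k)) (q := fun k => Fintype.card ι * ‖mean (s k)‖ ^ 2)
    hW.finiteTimeContraction hstep (fun k => by positivity) (fun k => ?_) N
  have mean_moves : ‖mean (x (k + 1) - x k)‖ ^ 2 = α ^ 2 * ‖mean (s k)‖ ^ 2 := by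
    rw [map_sub, h.mean_param_succ hW.mem_doublyStochastic, sub_sub_cancel_left, norm_neg,
      norm_smul, mul_pow, Real.norm_eq_abs, sq_abs]
  calc ‖center (a (k + 1)) - center (a k)‖ ^ 2
      ≤ (L * ‖x (k + 1) - x k‖) ^ 2 := by
        rw [← map_sub]
        exact pow_le_pow_left₀ (norm_nonneg _) ((norm_center_le _).trans (ha k)) 2
    _ = L ^ 2 * (‖center (x (k + 1)) - center (x k)‖ ^ 2
          + α ^ 2 * (Fintype.card ι * ‖mean (s k)‖ ^ 2)) := by
        rw [mul_pow, norm_sq_eq_norm_center_sq_add (x (k + 1) - x k), mean_moves, map_sub]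
        ring
    _ ≤ _ := by gcongr; exact norm_sub_sq_le_two _ _

end IsTracking

end Mixing

/-! ### Inexact gradient steps -/

section Smooth

open scoped NNReal

variable {E : Type*} [NormedAddCommGroup E] [InnerProductSpace ℝ E] [CompleteSpace E]
  {φ : E → ℝ} {L : ℝ≥0}

theorem hasDerivAt_line (hφ : Differentiable ℝ φ) (x v : E) (t : ℝ) :
    HasDerivAt (fun t : ℝ => φ (x + t • v)) (inner ℝ (gradient φ (x + t • v)) v) t := by
  have line : HasDerivAt (fun t : ℝ => x + t • v) v t := by
    simpa using ((hasDerivAt_id t).smul_const v).const_add x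
  have := (hφ (x + t • v)).hasFDerivAt.comp_hasDerivAt t line
  rwa [← inner_gradient_left] at this

theorem le_add_inner_add_norm_sq (hφ : Differentiable ℝ φ) (hL : LipschitzWith L (gradient φ))
    (x v : E) : φ (x + v) ≤ φ x + inner ℝ (gradient φ x) v + L / 2 * ‖v‖ ^ 2 := by
  set gap : ℝ → ℝ := fun t =>
    φ (x + t • v) - t * inner ℝ (gradient φ x) v - L / 2 * ‖v‖ ^ 2 * t ^ 2 with gap_def
  have hasDerivAt_gap (t : ℝ) : HasDerivAt gap
      (inner ℝ (gradient φ (x + t • v) - gradient φ x) v - L * ‖v‖ ^ 2 * t) t := by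
    refine (((hasDerivAt_line hφ x v t).sub
      ((hasDerivAt_id t).mul_const (inner ℝ (gradient φ x) v))).sub
      ((hasDerivAt_pow 2 t).const_mul (L / 2 * ‖v‖ ^ 2))).congr_deriv ?_
    rw [inner_sub_left]
    norm_num
    ring
  have antitone : AntitoneOn gap (Set.Icc 0 1) := by
    refine antitoneOn_of_deriv_nonpos (convex_Icc 0 1)
      (fun t _ => (hasDerivAt_gap t).continuousAt.continuousWithinAt)
      (fun t _ => (hasDerivAt_gap t).differentiableAt.differentiableWithinAt) fun t ht => ?_
    rw [interior_Icc] at ht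
    rw [(hasDerivAt_gap t).deriv, sub_nonpos]
    calc inner ℝ (gradient φ (x + t • v) - gradient φ x) v
        ≤ ‖gradient φ (x + t • v) - gradient φ x‖ * ‖v‖ := real_inner_le_norm _ _
      _ ≤ L * ‖x + t • v - x‖ * ‖v‖ := by gcongr; exact hL.norm_sub_le _ _
      _ = L * ‖v‖ ^ 2 * t := by
        rw [add_sub_cancel_left, norm_smul, Real.norm_of_nonneg ht.1.le]
        ring
  have gap_le : gap 1 ≤ gap 0 :=
    antitone (Set.left_mem_Icc.2 zero_le_one) (Set.right_mem_Icc.2 zero_le_one) zero_le_one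
  simp only [gap_def, one_smul, zero_smul, add_zero] at gap_le
  linarith

theorem inexact_gradient_step (hφ : Differentiable ℝ φ) (hL : LipschitzWith L (gradient φ))
    (α : ℝ) (x G b : E) :
    α / 2 * (‖G‖ ^ 2 + ‖gradient φ x‖ ^ 2)
      ≤ φ x - φ (x - α • (G + b)) + α / 2 * ‖gradient φ x - G‖ ^ 2
        - α * inner ℝ b (gradient φ x) + L * α ^ 2 * (‖G‖ ^ 2 + ‖b‖ ^ 2) := by
  have upper := le_add_inner_add_norm_sq hφ hL x (-(α • (G + b)))
  rw [← sub_eq_add_neg, inner_neg_right, inner_smul_right, inner_add_right, norm_neg, norm_smul,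
    mul_pow, Real.norm_eq_abs, sq_abs, real_inner_comm b] at upper
  have polarization := norm_sub_sq_real (gradient φ x) G
  have step_sq_le := mul_le_mul_of_nonneg_left (norm_add_sq_le_two G b)
    (by positivity : 0 ≤ L / 2 * α ^ 2)
  linear_combination upper + step_sq_le - α / 2 * polarization

end Smooth

section Objective

open scoped NNReal

variable {ι : Type*} [Fintype ι] {E : Type*} [NormedAddCommGroup E] [InnerProductSpace ℝ E]
  [CompleteSpace E] {φ : E → ℝ} {G : Stack ι E → Stack ι E} {L : ℝ≥0}

/-- The stack `G x` gathers the gradients of the local objectives, each at the point of its own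
agent, and `φ` is the mean of the local objectives: its gradient is the mean of the local ones
when all the agents are at the same point. -/
structure IsDistributedGradient (φ : E → ℝ) (G : Stack ι E → Stack ι E) (L : ℝ≥0) : Prop where
  lipschitzWith : LipschitzWith L G
  hasGradientAt : ∀ y, HasGradientAt φ (mean (G (replicate ι y))) y
  bddBelow : BddBelow (Set.range φ)

namespace IsDistributedGradient

theorem differentiable (h : IsDistributedGradient φ G L) : Differentiable ℝ φ :=
  fun y => (h.hasGradientAt y).differentiableAt

variable [Nonempty ι]

theorem card_mul_norm_mean_sub_sq_le (h : IsDistributedGradient φ G L) (u v : Stack ι E) :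
    Fintype.card ι * ‖mean (G u) - mean (G v)‖ ^ 2 ≤ L ^ 2 * ‖u - v‖ ^ 2 := by
  rw [← map_sub, ← mul_pow]
  exact (card_mul_norm_mean_sq_le _).trans
    (pow_le_pow_left₀ (norm_nonneg _) (h.lipschitzWith.norm_sub_le u v) 2)

theorem lipschitzWith_gradient (h : IsDistributedGradient φ G L) :
    LipschitzWith L (gradient φ) := by
  refine LipschitzWith.of_dist_le_mul fun x y => ?_
  have hcard : (0 : ℝ) < Fintype.card ι := by exact_mod_cast Fintype.card_pos
  have le := h.card_mul_norm_mean_sub_sq_le (replicate ι x) (replicate ι y)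
  rw [← (h.hasGradientAt x).gradient, ← (h.hasGradientAt y).gradient, ← map_sub,
    norm_replicate_sq, mul_left_comm, mul_le_mul_iff_right₀ hcard, ← mul_pow] at le
  rw [dist_eq_norm, dist_eq_norm]
  exact le_of_sq_le_sq le (by positivity)

theorem norm_gradient_sub_mean_sq_le (h : IsDistributedGradient φ G L) (x : Stack ι E) :
    ‖gradient φ (mean x) - mean (G x)‖ ^ 2 ≤ L ^ 2 / Fintype.card ι * ‖center x‖ ^ 2 := by
  have hcard : (0 : ℝ) < Fintype.card ι := by exact_mod_cast Fintype.card_pos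
  have le := h.card_mul_norm_mean_sub_sq_le (replicate ι (mean x)) x
  rw [(h.hasGradientAt (mean x)).gradient, center_apply, norm_sub_rev x, div_mul_eq_mul_div,
    le_div_iff₀ hcard]
  linarith

theorem descent (h : IsDistributedGradient φ G L) {α : ℝ} (hα : 0 ≤ α) (x e : Stack ι E) :
    α / 2 * (‖mean (G x)‖ ^ 2 + ‖gradient φ (mean x)‖ ^ 2)
      ≤ φ (mean x) - φ (mean x - α • mean (G x + e))
        + α * L ^ 2 / (2 * Fintype.card ι) * ‖center x‖ ^ 2
        - α * inner ℝ (mean e) (gradient φ (mean x))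
        + L * α ^ 2 * (‖mean (G x)‖ ^ 2 + ‖mean e‖ ^ 2) := by
  have step := inexact_gradient_step h.differentiable h.lipschitzWith_gradient α (mean x)
    (mean (G x)) (mean e)
  have bias := mul_le_mul_of_nonneg_left (h.norm_gradient_sub_mean_sq_le x)
    (by positivity : 0 ≤ α / 2)
  rw [map_add]
  linear_combination step + bias

end IsDistributedGradient

end Objective

/-! ### Martingale differences -/

section MartingaleDifference

open scoped NNReal

variable {Ω : Type*} {m₀ : MeasurableSpace Ω} {μ : Measure Ω} {H H' : Type*}
  [NormedAddCommGroup H] [InnerProductSpace ℝ H] [NormedAddCommGroup H'] [InnerProductSpace ℝ H']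

theorem integrable_inner {u v : Ω → H} (hu : MemLp u 2 μ) (hv : MemLp v 2 μ) :
    Integrable (fun ω => inner ℝ (u ω) (v ω)) μ :=
  memLp_one_iff_integrable.1 ((innerSL ℝ).memLp_of_bilin 1 hu hv)

theorem integral_norm_sum_sq_of_orthogonal {κ : Type*} (s : Finset κ) {u : κ → Ω → H}
    (hu : ∀ j, MemLp (u j) 2 μ) (orthogonal : ∀ i j, i ≠ j → ∫ ω, inner ℝ (u i ω) (u j ω) ∂μ = 0) :
    ∫ ω, ‖∑ j ∈ s, u j ω‖ ^ 2 ∂μ = ∑ j ∈ s, ∫ ω, ‖u j ω‖ ^ 2 ∂μ := by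
  simp only [← real_inner_self_eq_norm_sq, sum_inner, inner_sum]
  rw [integral_finsetSum _ fun i _ => integrable_finsetSum _ fun j _ =>
    integrable_inner (hu j) (hu i)]
  refine Finset.sum_congr rfl fun i hi => ?_
  rw [integral_finsetSum _ fun j _ => integrable_inner (hu j) (hu i)]
  exact Finset.sum_eq_single_of_mem i hi fun j _ hj => orthogonal j i hj

theorem memLp_comp_of_lipschitzWith {E F : Type*} [NormedAddCommGroup E] [NormedAddCommGroup F]
    [IsFiniteMeasure μ] {p : ENNReal} {G : E → F} {L : ℝ≥0} (hG : LipschitzWith L G) {u : Ω → E}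
    (hu : MemLp u p μ) : MemLp (fun ω => G (u ω)) p μ := by
  have vanishing : MemLp ((fun x => G x - G 0) ∘ u) p μ :=
    LipschitzWith.comp_memLp (K := L)
      (LipschitzWith.of_dist_le_mul fun x y => by simpa using hG.dist_le_mul x y) (sub_self _) hu
  exact (vanishing.add (memLp_const (G 0))).ae_eq (.of_forall fun ω => sub_add_cancel _ _)

/-- A sequence of square integrable vectors, `e k` being known at time `k + 1` and of zero
conditional mean given what is known at time `k`. -/
structure IsMartingaleDifference (μ : Measure Ω) (𝒢 : Filtration ℕ m₀) (e : ℕ → Ω → H) :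
    Prop where
  memLp : ∀ k, MemLp (e k) 2 μ
  stronglyMeasurable : ∀ k, StronglyMeasurable[𝒢 (k + 1)] (e k)
  condExp_eq_zero : ∀ k, μ[e k | 𝒢 k] =ᵐ[μ] 0

namespace IsMartingaleDifference

variable {𝒢 : Filtration ℕ m₀} {e : ℕ → Ω → H}

theorem memLp_sum (h : IsMartingaleDifference μ 𝒢 e) (S : ℕ → H →L[ℝ] H') (s : Finset ℕ) :
    MemLp (fun ω => ∑ j ∈ s, S j (e j ω)) 2 μ :=
  memLp_finsetSum _ fun j _ => (S j).comp_memLp' (h.memLp j)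

variable [CompleteSpace H] [CompleteSpace H'] [IsFiniteMeasure μ]

theorem map (h : IsMartingaleDifference μ 𝒢 e) (S : H →L[ℝ] H') :
    IsMartingaleDifference μ 𝒢 fun k ω => S (e k ω) where
  memLp k := S.comp_memLp' (h.memLp k)
  stronglyMeasurable k := S.continuous.comp_stronglyMeasurable (h.stronglyMeasurable k)
  condExp_eq_zero k := by
    filter_upwards [S.comp_condExp_comm (m := 𝒢 k) ((h.memLp k).integrable one_le_two),
      h.condExp_eq_zero k] with ω comm zero
    rw [Function.comp_apply, zero, Pi.zero_apply, map_zero] at comm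
    exact comm.symm

theorem integral_inner_eq_zero (h : IsMartingaleDifference μ 𝒢 e) {k : ℕ} {Y : Ω → H}
    (hY : StronglyMeasurable[𝒢 k] Y) (hY2 : MemLp Y 2 μ) :
    ∫ ω, inner ℝ (e k ω) (Y ω) ∂μ = 0 := by
  rw [← integral_condExp (𝒢.le k)]
  refine integral_eq_zero_of_ae ?_
  filter_upwards [condExp_bilin_of_stronglyMeasurable_right (innerSL ℝ) hY
    (integrable_inner (h.memLp k) hY2) ((h.memLp k).integrable one_le_two),
    h.condExp_eq_zero k] with ω pull_out zero
  refine pull_out.trans ?_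
  rw [zero, Pi.zero_apply, map_zero]
  rfl

theorem integral_inner_eq_zero_of_ne (h : IsMartingaleDifference μ 𝒢 e) (S : ℕ → H →L[ℝ] H')
    {i j : ℕ} (hij : i ≠ j) : ∫ ω, inner ℝ (S i (e i ω)) (S j (e j ω)) ∂μ = 0 := by
  wlog hlt : i < j generalizing i j
  · simpa only [real_inner_comm] using this hij.symm (hij.symm.lt_of_le (not_lt.1 hlt))
  have past : StronglyMeasurable[𝒢 j] (e i) := (h.stronglyMeasurable i).mono (𝒢.mono hlt)
  simpa only [real_inner_comm] using (h.map (S j)).integral_inner_eq_zero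
    ((S i).continuous.comp_stronglyMeasurable past) ((S i).comp_memLp' (h.memLp i))

theorem integral_norm_sum_sq_le (h : IsMartingaleDifference μ 𝒢 e) {V : ℝ}
    (hV : ∀ k, ∫ ω, ‖e k ω‖ ^ 2 ∂μ ≤ V) (S : ℕ → H →L[ℝ] H') (s : Finset ℕ) :
    ∫ ω, ‖∑ j ∈ s, S j (e j ω)‖ ^ 2 ∂μ ≤ (∑ j ∈ s, ‖S j‖ ^ 2) * V := by
  have memLp_apply : ∀ j, MemLp (fun ω => S j (e j ω)) 2 μ := fun j => (S j).comp_memLp' (h.memLp j)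
  rw [integral_norm_sum_sq_of_orthogonal s memLp_apply fun i j =>
    h.integral_inner_eq_zero_of_ne S, Finset.sum_mul]
  refine Finset.sum_le_sum fun j _ => ?_
  calc ∫ ω, ‖S j (e j ω)‖ ^ 2 ∂μ ≤ ∫ ω, ‖S j‖ ^ 2 * ‖e j ω‖ ^ 2 ∂μ := by
        refine integral_mono (memLp_apply j).norm.integrable_sq
          ((h.memLp j).norm.integrable_sq.const_mul _) fun ω => ?_
        simp only [← mul_pow]
        exact pow_le_pow_left₀ (norm_nonneg _) ((S j).le_opNorm _) 2
    _ ≤ ‖S j‖ ^ 2 * V := by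
        rw [integral_const_mul]
        exact mul_le_mul_of_nonneg_left (hV j) (sq_nonneg _)

end IsMartingaleDifference

end MartingaleDifference

/-! ### Expected progress -/

section StepSize

theorem mul_add_le_div_six {κ τ s q : ℝ} (hκ : 0 ≤ κ) (hτ : 1 ≤ τ)
    (hstep : 48 * (κ * τ ^ 2) ^ 2 ≤ 1) (hs : 0 ≤ s) (hq : 0 ≤ q) :
    κ * (s + τ * q) ≤ (s + q) / 6 := by
  have step_le : κ * τ ^ 2 ≤ 1 / 6 := by nlinarith [sq_nonneg (κ * τ ^ 2 - 1 / 6)]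
  have mul_τ_le : κ * τ ≤ 1 / 6 :=
    (mul_le_mul_of_nonneg_left (le_self_pow₀ hτ two_ne_zero) hκ).trans step_le
  have le : κ ≤ 1 / 6 := (le_mul_of_one_le_right hκ hτ).trans mul_τ_le
  linarith [mul_le_mul_of_nonneg_right le hs, mul_le_mul_of_nonneg_right mul_τ_le hq]

theorem sq_mul_add_le_div_forty_eight {κ τ s q : ℝ} (hτ : 1 ≤ τ)
    (hstep : 48 * (κ * τ ^ 2) ^ 2 ≤ 1) (hs : 0 ≤ s) (hq : 0 ≤ q) :
    κ ^ 2 * (s + τ * q) ≤ (s + q) / 48 := by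
  have step_le : κ ^ 2 * τ ^ 4 ≤ 1 / 48 := by linarith
  have mul_τ_le : κ ^ 2 * τ ≤ 1 / 48 :=
    (mul_le_mul_of_nonneg_left (le_self_pow₀ hτ (by norm_num)) (sq_nonneg κ)).trans step_le
  have le : κ ^ 2 ≤ 1 / 48 := (le_mul_of_one_le_right (sq_nonneg κ) hτ).trans mul_τ_le
  linarith [mul_le_mul_of_nonneg_right le hs, mul_le_mul_of_nonneg_right mul_τ_le hq]

theorem le_of_descent_of_disagreement {α L τ n S X Δ D B q : ℝ} (hα : 0 < α) (hL : 0 ≤ L)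
    (hτ : 1 ≤ τ) (hn : 0 < n) (hS : 0 ≤ S) (hΔ : 0 ≤ Δ) (hD : 0 ≤ D) (hB : 0 ≤ B) (hq : 0 ≤ q)
    (hstep : 48 * (α * L * τ ^ 2) ^ 2 ≤ 1)
    (descent : α / 2 * S ≤ Δ + α * L ^ 2 / (2 * n) * X + L * α ^ 2 * (S + τ * q))
    (disagreement : X ≤ α ^ 2 * n * (S + τ * q) + 24 * (τ * D + α ^ 2 * τ ^ 3 * B)
      + 12 * α ^ 2 * (32 * τ ^ 3 * (n * (τ * q)))) :
    S ≤ 48 * (Δ / α + L ^ 2 * (τ * (n⁻¹ * D) + α ^ 2 * τ ^ 3 * (n⁻¹ * B))) + 18 * q := by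
  have := zero_lt_one.trans_le hτ
  set R := L ^ 2 * (τ * (n⁻¹ * D) + α ^ 2 * τ ^ 3 * (n⁻¹ * B)) with hR
  have hR0 : 0 ≤ R := by positivity
  have hΔα : 0 ≤ Δ / α := by positivity
  have descent' : S ≤ 2 * (Δ / α) + L ^ 2 / n * X + 2 * (α * L * (S + τ * q)) := by
    have := mul_le_mul_of_nonneg_left descent (by positivity : 0 ≤ 2 / α)
    field_simp at this ⊢
    linarith
  have disagreement' : L ^ 2 / n * X
      ≤ (α * L) ^ 2 * (S + τ * q) + 24 * R + 384 * (α * L * τ ^ 2) ^ 2 * q := by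
    refine (mul_le_mul_of_nonneg_left disagreement (by positivity : 0 ≤ L ^ 2 / n)).trans_eq ?_
    rw [hR]
    field_simp
    ring
  have noise_le : 384 * (α * L * τ ^ 2) ^ 2 * q ≤ 8 * q :=
    mul_le_mul_of_nonneg_right (by linarith) hq
  linarith [mul_add_le_div_six (by positivity : 0 ≤ α * L) hτ hstep hS hq,
    sq_mul_add_le_div_forty_eight hτ hstep hS hq]

end StepSize

section ExpectedProgress

open scoped NNReal

variable {Ω : Type*} {m₀ : MeasurableSpace Ω} {μ : Measure Ω}
  {E : Type*} [NormedAddCommGroup E] [InnerProductSpace ℝ E]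
  {ι : Type*} [Fintype ι] {φ : E → ℝ} {G : Stack ι E → Stack ι E} {L : ℝ≥0}

theorem memLp_mean {p : ENNReal} {u : Ω → Stack ι E} (hu : MemLp u p μ) :
    MemLp (fun ω => mean (u ω)) p μ :=
  (mean : Stack ι E →L[ℝ] E).comp_memLp' hu

theorem memLp_center {p : ENNReal} {u : Ω → Stack ι E} (hu : MemLp u p μ) :
    MemLp (fun ω => center (u ω)) p μ :=
  (center : Stack ι E →L[ℝ] Stack ι E).comp_memLp' hu

section Stationarity

variable [CompleteSpace E]

theorem integrable_comp_of_lipschitzWith_gradient [IsFiniteMeasure μ] {φ : E → ℝ} {L : ℝ≥0}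
    (hφ : Differentiable ℝ φ) (hL : LipschitzWith L (gradient φ)) (hbdd : BddBelow (Set.range φ))
    {X : Ω → E} (hX : MemLp X 2 μ) : Integrable (fun ω => φ (X ω)) μ := by
  obtain ⟨b, hb⟩ := hbdd
  refine integrable_of_le_of_le (hφ.continuous.comp_aestronglyMeasurable hX.1)
    (.of_forall fun ω => hb ⟨X ω, rfl⟩)
    (.of_forall fun ω => by simpa using le_add_inner_add_norm_sq hφ hL 0 (X ω))
    (integrable_const b) (((integrable_const _).add ?_).add (hX.norm.integrable_sq.const_mul _))
  exact (fderiv ℝ φ 0).integrable_comp (hX.integrable one_le_two)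

/-- The squared norms of the mean of the local gradients `G v` and of the gradient of `φ` at the
mean, whose expected sum along the iterates is to be bounded. -/
def stationarity (φ : E → ℝ) (G : Stack ι E → Stack ι E) (v : Stack ι E) : ℝ :=
  ‖mean (G v)‖ ^ 2 + ‖gradient φ (mean v)‖ ^ 2

theorem integrable_stationarity [IsFiniteMeasure μ] [Nonempty ι]
    (hφ : IsDistributedGradient φ G L) {X : Ω → Stack ι E} (hX : MemLp X 2 μ) :
    Integrable (fun ω => stationarity φ G (X ω)) μ :=
  (memLp_mean (memLp_comp_of_lipschitzWith hφ.lipschitzWith hX)).norm.integrable_sq.add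
    (memLp_comp_of_lipschitzWith hφ.lipschitzWith_gradient
      (memLp_mean hX)).norm.integrable_sq

end Stationarity

variable [DecidableEq ι]

theorem memLp_mixL (W : Matrix ι ι ℝ) {p : ENNReal} {u : Ω → Stack ι E} (hu : MemLp u p μ) :
    MemLp (fun ω => mixL W (u ω)) p μ :=
  (mixL W : Stack ι E →L[ℝ] Stack ι E).comp_memLp' hu

/-- Gradient tracking from a random start `x 0`, each stochastic gradient being the gradient
`G (x k)` plus a martingale difference `e k` whose variance is at most `V` per agent. -/
structure IsNoisyTracking (μ : Measure Ω) (𝒢 : Filtration ℕ m₀) (W : ℕ → Matrix ι ι ℝ) (α V : ℝ)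
    (G : Stack ι E → Stack ι E) (x g e : ℕ → Ω → Stack ι E) : Prop where
  isTracking : ∀ ω, IsTracking (fun k => mixL (W k)) α (fun k => x k ω) (fun k => g k ω)
    fun k => G (x k ω) + e k ω
  memLp_zero : MemLp (x 0) 2 μ
  stronglyMeasurable : ∀ k, StronglyMeasurable[𝒢 k] (x k)
  noise : IsMartingaleDifference μ 𝒢 e
  integral_noise_sq_le : ∀ k, ∫ ω, ‖e k ω‖ ^ 2 ∂μ ≤ Fintype.card ι * V

namespace IsNoisyTracking

variable {𝒢 : Filtration ℕ m₀} {W : ℕ → Matrix ι ι ℝ} {α V : ℝ} {x g e : ℕ → Ω → Stack ι E}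

theorem param_succ (h : IsNoisyTracking μ 𝒢 W α V G x g e) (k : ℕ) :
    x (k + 1) = fun ω => mixL (W k) (x k ω - α • g k ω) :=
  funext fun ω => (h.isTracking ω).param_succ k

theorem tracker_zero (h : IsNoisyTracking μ 𝒢 W α V G x g e) :
    g 0 = fun ω => G (x 0 ω) + e 0 ω :=
  funext fun ω => (h.isTracking ω).tracker_zero

theorem tracker_succ (h : IsNoisyTracking μ 𝒢 W α V G x g e) (k : ℕ) :
    g (k + 1) = fun ω => mixL (W k) (g k ω)
      + (G (x (k + 1) ω) + e (k + 1) ω - (G (x k ω) + e k ω)) :=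
  funext fun ω => (h.isTracking ω).tracker_succ k

theorem memLp_param_and_tracker [IsFiniteMeasure μ] (h : IsNoisyTracking μ 𝒢 W α V G x g e)
    (hG : LipschitzWith L G) (k : ℕ) : MemLp (x k) 2 μ ∧ MemLp (g k) 2 μ := by
  have memLp_gradient {k : ℕ} (hx : MemLp (x k) 2 μ) :
      MemLp (fun ω => G (x k ω) + e k ω) 2 μ :=
    (memLp_comp_of_lipschitzWith hG hx).add (h.noise.memLp k)
  induction k with
  | zero => exact ⟨h.memLp_zero, h.tracker_zero ▸ memLp_gradient h.memLp_zero⟩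
  | succ k ih =>
    obtain ⟨memLp_param, memLp_tracker⟩ := ih
    have memLp_succ : MemLp (x (k + 1)) 2 μ := by
      rw [h.param_succ]
      exact memLp_mixL (W k) (memLp_param.sub (memLp_tracker.const_smul α))
    refine ⟨memLp_succ, ?_⟩
    rw [h.tracker_succ]
    exact (memLp_mixL (W k) memLp_tracker).add
      ((memLp_gradient memLp_succ).sub (memLp_gradient memLp_param))

theorem integral_norm_mean_noise_sq_le [Nonempty ι] (h : IsNoisyTracking μ 𝒢 W α V G x g e)
    (k : ℕ) : ∫ ω, ‖mean (e k ω)‖ ^ 2 ∂μ ≤ V := by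
  have hcard : (0 : ℝ) < Fintype.card ι := by exact_mod_cast Fintype.card_pos
  refine le_of_mul_le_mul_left (le_trans ?_ (h.integral_noise_sq_le k)) hcard
  rw [← integral_const_mul]
  exact integral_mono ((memLp_mean (h.noise.memLp k)).norm.integrable_sq.const_mul _)
    (h.noise.memLp k).norm.integrable_sq fun ω => card_mul_norm_mean_sq_le _

variable [CompleteSpace E]

theorem integrable_norm_sum_noiseKernel_sq [IsFiniteMeasure μ]
    (h : IsNoisyTracking μ 𝒢 W α V G x g e) (m : ℕ) : Integrable (fun ω => ‖∑ j ∈ Finset.range m,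
      noiseKernel (disagreementOp W) m j (center (e j ω))‖ ^ 2) μ :=
  ((h.noise.map center).memLp_sum (noiseKernel (disagreementOp W) m) _).norm.integrable_sq

theorem integral_norm_sum_noiseKernel_sq_le [IsFiniteMeasure μ] [Nonempty ι]
    (h : IsNoisyTracking μ 𝒢 W α V G x g e) {τ : ℕ}
    (hW : PeriodicConsensus τ W) (m : ℕ) :
    ∫ ω, ‖∑ j ∈ Finset.range m, noiseKernel (disagreementOp W) m j (center (e j ω))‖ ^ 2 ∂μ
      ≤ 32 * (τ : ℝ) ^ 3 * (Fintype.card ι * V) := by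
  have centered : IsMartingaleDifference μ 𝒢 fun k ω => center (e k ω) := h.noise.map center
  have variance_le : ∀ k, ∫ ω, ‖center (e k ω)‖ ^ 2 ∂μ ≤ Fintype.card ι * V := fun k =>
    (integral_mono (centered.memLp k).norm.integrable_sq (h.noise.memLp k).norm.integrable_sq
      fun ω => pow_le_pow_left₀ (norm_nonneg _) (norm_center_le _) 2).trans
      (h.integral_noise_sq_le k)
  refine (centered.integral_norm_sum_sq_le variance_le _ _).trans ?_
  refine mul_le_mul_of_nonneg_right (hW.finiteTimeContraction.sum_norm_noiseKernel_sq_le m) ?_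
  exact (integral_nonneg fun ω => sq_nonneg _).trans (variance_le 0)

end IsNoisyTracking

variable [CompleteSpace E]

namespace IsNoisyTracking

variable {𝒢 : Filtration ℕ m₀} {W : ℕ → Matrix ι ι ℝ} {α V : ℝ} {x g e : ℕ → Ω → Stack ι E}

theorem sum_norm_center_sq_le [Nonempty ι] (h : IsNoisyTracking μ 𝒢 W α V G x g e)
    (hG : LipschitzWith L G) {τ : ℕ} (hW : PeriodicConsensus τ W)
    (hstep : 48 * (α * L * τ ^ 2) ^ 2 ≤ 1) (N : ℕ) (ω : Ω) :
    ∑ k ∈ Finset.range N, ‖center (x k ω)‖ ^ 2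
      ≤ α ^ 2 * Fintype.card ι * (∑ k ∈ Finset.range N, stationarity φ G (x k ω)
          + ∑ k ∈ Finset.range N, ‖mean (e k ω)‖ ^ 2)
        + 24 * (τ * ‖center (x 0 ω)‖ ^ 2 + α ^ 2 * τ ^ 3 * ‖center (G (x 0 ω))‖ ^ 2)
        + 12 * α ^ 2 * ∑ m ∈ Finset.range N, ‖∑ j ∈ Finset.range m,
            noiseKernel (disagreementOp W) m j (center (e j ω))‖ ^ 2 := by
  have bound := (h.isTracking ω).sum_norm_center_sq_le (a := fun k => G (x k ω)) hW hstep
    (fun k => hG.norm_sub_le (x (k + 1) ω) (x k ω)) N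
  have mean_le : ∑ k ∈ Finset.range N, (Fintype.card ι : ℝ) * ‖mean (G (x k ω) + e k ω)‖ ^ 2
      ≤ 2 * Fintype.card ι * (∑ k ∈ Finset.range N, stationarity φ G (x k ω)
        + ∑ k ∈ Finset.range N, ‖mean (e k ω)‖ ^ 2) := by
    rw [← Finset.sum_add_distrib, Finset.mul_sum]
    refine Finset.sum_le_sum fun k _ => ?_
    rw [map_add, mul_comm 2, mul_assoc]
    gcongr
    refine (norm_add_sq_le_two _ _).trans ?_
    rw [stationarity]
    gcongr
    exact le_add_of_nonneg_right (sq_nonneg _)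
  simp only [add_sub_cancel_left] at bound
  linarith [mul_le_mul_of_nonneg_left mean_le (by positivity : 0 ≤ α ^ 2 / 2)]

variable [IsProbabilityMeasure μ]

theorem memLp_param (h : IsNoisyTracking μ 𝒢 W α V G x g e) (hφ : IsDistributedGradient φ G L)
    (k : ℕ) : MemLp (x k) 2 μ :=
  (h.memLp_param_and_tracker hφ.lipschitzWith k).1

variable [Nonempty ι]

theorem integrable_objective (h : IsNoisyTracking μ 𝒢 W α V G x g e)
    (hφ : IsDistributedGradient φ G L) (k : ℕ) : Integrable (fun ω => φ (mean (x k ω))) μ :=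
  integrable_comp_of_lipschitzWith_gradient hφ.differentiable hφ.lipschitzWith_gradient
    hφ.bddBelow (memLp_mean (h.memLp_param hφ k))

theorem expected_descent (h : IsNoisyTracking μ 𝒢 W α V G x g e)
    (hφ : IsDistributedGradient φ G L) (hW : ∀ k, W k ∈ doublyStochastic ℝ ι) (hα : 0 ≤ α)
    (k : ℕ) :
    α / 2 * ∫ ω, stationarity φ G (x k ω) ∂μ
      ≤ (∫ ω, φ (mean (x k ω)) ∂μ) - (∫ ω, φ (mean (x (k + 1) ω)) ∂μ)
        + α * L ^ 2 / (2 * Fintype.card ι) * ∫ ω, ‖center (x k ω)‖ ^ 2 ∂μ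
        + L * α ^ 2 * ((∫ ω, stationarity φ G (x k ω) ∂μ) + V) := by
  have memLp_x := h.memLp_param hφ k
  have mean_noise : IsMartingaleDifference μ 𝒢 fun k ω => mean (e k ω) := h.noise.map mean
  have gradient_memLp : MemLp (fun ω => gradient φ (mean (x k ω))) 2 μ :=
    memLp_comp_of_lipschitzWith hφ.lipschitzWith_gradient (memLp_mean memLp_x)
  have unbiased : ∫ ω, inner ℝ (mean (e k ω)) (gradient φ (mean (x k ω))) ∂μ = 0 :=
    mean_noise.integral_inner_eq_zero (hφ.lipschitzWith_gradient.continuous.comp_stronglyMeasurable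
      (mean.continuous.comp_stronglyMeasurable (h.stronglyMeasurable k))) gradient_memLp
  have objective_int := h.integrable_objective hφ k
  have next_objective_int := h.integrable_objective hφ (k + 1)
  have stationarity_int := integrable_stationarity hφ memLp_x
  have inner_int := integrable_inner (mean_noise.memLp k) gradient_memLp
  have noise_int := (mean_noise.memLp k).norm.integrable_sq
  have center_int : Integrable (fun ω => ‖center (x k ω)‖ ^ 2) μ :=
    (memLp_center memLp_x).norm.integrable_sq
  have pointwise (ω : Ω) : α / 2 * stationarity φ G (x k ω)
      ≤ φ (mean (x k ω)) - φ (mean (x (k + 1) ω))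
        + α * L ^ 2 / (2 * Fintype.card ι) * ‖center (x k ω)‖ ^ 2
        - α * inner ℝ (mean (e k ω)) (gradient φ (mean (x k ω)))
        + L * α ^ 2 * (stationarity φ G (x k ω) + ‖mean (e k ω)‖ ^ 2) := by
    rw [(h.isTracking ω).mean_param_succ hW k]
    refine (hφ.descent hα (x k ω) (e k ω)).trans ?_
    rw [stationarity]
    gcongr
    exact le_add_of_nonneg_right (sq_nonneg _)
  have integrated := integral_mono (stationarity_int.const_mul _)
    (by apply_rules [Integrable.sub, Integrable.add, Integrable.const_mul]) pointwise
  simp (disch := apply_rules [Integrable.sub, Integrable.add, Integrable.const_mul]) only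
    [integral_add, integral_sub, integral_const_mul, unbiased] at integrated
  refine integrated.trans ?_
  rw [mul_zero, sub_zero]
  gcongr
  exact h.integral_norm_mean_noise_sq_le k

theorem iInf_le_integral_objective (h : IsNoisyTracking μ 𝒢 W α V G x g e)
    (hφ : IsDistributedGradient φ G L) (k : ℕ) : ⨅ y, φ y ≤ ∫ ω, φ (mean (x k ω)) ∂μ := by
  simpa using integral_mono (integrable_const (⨅ y, φ y)) (h.integrable_objective hφ k)
    fun ω => ciInf_le hφ.bddBelow (mean (x k ω))

theorem sum_expected_descent (h : IsNoisyTracking μ 𝒢 W α V G x g e)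
    (hφ : IsDistributedGradient φ G L) (hW : ∀ k, W k ∈ doublyStochastic ℝ ι) (hα : 0 ≤ α)
    (N : ℕ) :
    α / 2 * ∑ k ∈ Finset.range N, ∫ ω, stationarity φ G (x k ω) ∂μ
      ≤ (∫ ω, φ (mean (x 0 ω)) ∂μ) - (⨅ y, φ y)
        + α * L ^ 2 / (2 * Fintype.card ι)
          * ∑ k ∈ Finset.range N, ∫ ω, ‖center (x k ω)‖ ^ 2 ∂μ
        + L * α ^ 2 * (∑ k ∈ Finset.range N, ∫ ω, stationarity φ G (x k ω) ∂μ + N * V) := by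
  have summed := Finset.sum_le_sum fun k (_ : k ∈ Finset.range N) =>
    h.expected_descent hφ hW hα k
  simp only [Finset.sum_add_distrib, ← Finset.mul_sum, Finset.sum_const, Finset.card_range,
    nsmul_eq_mul, Finset.sum_range_sub' fun k => ∫ ω, φ (mean (x k ω)) ∂μ] at summed
  linarith [h.iInf_le_integral_objective hφ N]

theorem sum_integral_norm_center_sq_le (h : IsNoisyTracking μ 𝒢 W α V G x g e)
    (hφ : IsDistributedGradient φ G L) {τ : ℕ} (hW : PeriodicConsensus τ W)
    (hstep : 48 * (α * L * τ ^ 2) ^ 2 ≤ 1) (N : ℕ) :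
    ∑ k ∈ Finset.range N, ∫ ω, ‖center (x k ω)‖ ^ 2 ∂μ
      ≤ α ^ 2 * Fintype.card ι
          * (∑ k ∈ Finset.range N, ∫ ω, stationarity φ G (x k ω) ∂μ
            + ∑ k ∈ Finset.range N, ∫ ω, ‖mean (e k ω)‖ ^ 2 ∂μ)
        + 24 * (τ * ∫ ω, ‖center (x 0 ω)‖ ^ 2 ∂μ
          + α ^ 2 * τ ^ 3 * ∫ ω, ‖center (G (x 0 ω))‖ ^ 2 ∂μ)
        + 12 * α ^ 2 * ∑ m ∈ Finset.range N, ∫ ω, ‖∑ j ∈ Finset.range m,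
            noiseKernel (disagreementOp W) m j (center (e j ω))‖ ^ 2 ∂μ := by
  have memLp_x := h.memLp_param hφ
  have center_int (k : ℕ) : Integrable (fun ω => ‖center (x k ω)‖ ^ 2) μ :=
    (memLp_center (memLp_x k)).norm.integrable_sq
  have gradient_int : Integrable (fun ω => ‖center (G (x 0 ω))‖ ^ 2) μ :=
    (memLp_center (memLp_comp_of_lipschitzWith hφ.lipschitzWith (memLp_x 0))).norm.integrable_sq
  have stationarity_int (k : ℕ) := integrable_stationarity hφ (memLp_x k)
  have mean_noise_int (k : ℕ) : Integrable (fun ω => ‖mean (e k ω)‖ ^ 2) μ :=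
    (memLp_mean (h.noise.memLp k)).norm.integrable_sq
  have noise_int := h.integrable_norm_sum_noiseKernel_sq (W := W)
  have sum_center_int := integrable_finsetSum (Finset.range N) fun k _ => center_int k
  have sum_stationarity_int := integrable_finsetSum (Finset.range N) fun k _ => stationarity_int k
  have sum_mean_noise_int := integrable_finsetSum (Finset.range N) fun k _ => mean_noise_int k
  have sum_noise_int := integrable_finsetSum (Finset.range N) fun k _ => noise_int k
  have stationarity_add_int := (sum_stationarity_int.add sum_mean_noise_int).const_mul
    (α ^ 2 * Fintype.card ι)
  have initial_int := (((center_int 0).const_mul (τ : ℝ)).add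
    (gradient_int.const_mul (α ^ 2 * (τ : ℝ) ^ 3))).const_mul 24
  have integrated := integral_mono sum_center_int
    ((stationarity_add_int.add initial_int).add (sum_noise_int.const_mul (12 * α ^ 2)))
    (h.sum_norm_center_sq_le (φ := φ) hφ.lipschitzWith hW hstep N)
  rwa [integral_finsetSum _ fun k _ => center_int k,
    integral_add' (stationarity_add_int.add initial_int) (sum_noise_int.const_mul _),
    integral_add' stationarity_add_int initial_int, integral_const_mul, integral_const_mul,
    integral_const_mul, integral_add' sum_stationarity_int sum_mean_noise_int,
    integral_finsetSum _ fun k _ => stationarity_int k,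
    integral_finsetSum _ fun k _ => mean_noise_int k,
    integral_finsetSum _ fun k _ => noise_int k,
    integral_add' ((center_int 0).const_mul _) (gradient_int.const_mul _),
    integral_const_mul, integral_const_mul] at integrated

theorem sum_expected_disagreement_le (h : IsNoisyTracking μ 𝒢 W α V G x g e)
    (hφ : IsDistributedGradient φ G L) {τ : ℕ} (hW : PeriodicConsensus τ W)
    (hstep : 48 * (α * L * τ ^ 2) ^ 2 ≤ 1) (N : ℕ) :
    ∑ k ∈ Finset.range N, ∫ ω, ‖center (x k ω)‖ ^ 2 ∂μ
      ≤ α ^ 2 * Fintype.card ι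
          * (∑ k ∈ Finset.range N, ∫ ω, stationarity φ G (x k ω) ∂μ + N * V)
        + 24 * (τ * ∫ ω, ‖center (x 0 ω)‖ ^ 2 ∂μ
          + α ^ 2 * τ ^ 3 * ∫ ω, ‖center (G (x 0 ω))‖ ^ 2 ∂μ)
        + 12 * α ^ 2 * (32 * τ ^ 3 * (Fintype.card ι * (N * V))) := by
  refine (h.sum_integral_norm_center_sq_le hφ hW hstep N).trans ?_
  have mean_noise_le := Finset.sum_le_sum fun k (_ : k ∈ Finset.range N) =>
    h.integral_norm_mean_noise_sq_le k
  have noise_le := Finset.sum_le_sum fun m (_ : m ∈ Finset.range N) =>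
    h.integral_norm_sum_noiseKernel_sq_le hW m
  simp only [Finset.sum_const, Finset.card_range, nsmul_eq_mul] at mean_noise_le noise_le
  linarith [mul_le_mul_of_nonneg_left mean_noise_le (by positivity : 0 ≤ α ^ 2 * Fintype.card ι),
    mul_le_mul_of_nonneg_left noise_le (by positivity : 0 ≤ 12 * α ^ 2)]

theorem sum_integral_stationarity_le (h : IsNoisyTracking μ 𝒢 W α V G x g e)
    (hφ : IsDistributedGradient φ G L) {τ : ℕ} (hW : PeriodicConsensus τ W) (hα : 0 < α)
    (hstep : 48 * (α * L * τ ^ 2) ^ 2 ≤ 1) (N : ℕ) :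
    ∑ k ∈ Finset.range N, ∫ ω, stationarity φ G (x k ω) ∂μ
      ≤ 48 * (((∫ ω, φ (mean (x 0 ω)) ∂μ) - ⨅ y, φ y) / α
          + L ^ 2 * (τ * ((Fintype.card ι : ℝ)⁻¹ * ∫ ω, ‖center (x 0 ω)‖ ^ 2 ∂μ)
            + α ^ 2 * τ ^ 3
              * ((Fintype.card ι : ℝ)⁻¹ * ∫ ω, ‖center (G (x 0 ω))‖ ^ 2 ∂μ)))
        + 18 * (N * V / τ) := by
  have one_le : (1 : ℝ) ≤ τ := by exact_mod_cast hW.one_le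
  have variance_nonneg : 0 ≤ V :=
    (integral_nonneg fun ω => sq_nonneg _).trans (h.integral_norm_mean_noise_sq_le 0)
  have noise_eq : τ * (N * V / τ) = N * V := mul_div_cancel₀ _ (by positivity)
  refine le_of_descent_of_disagreement
    (X := ∑ k ∈ Finset.range N, ∫ ω, ‖center (x k ω)‖ ^ 2 ∂μ) hα L.coe_nonneg one_le
    (by exact_mod_cast Fintype.card_pos)
    (Finset.sum_nonneg fun k _ => integral_nonneg fun ω => by unfold stationarity; positivity)
    (sub_nonneg.2 (h.iInf_le_integral_objective hφ 0)) (integral_nonneg fun ω => sq_nonneg _)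
    (integral_nonneg fun ω => sq_nonneg _) (by positivity) hstep ?_ ?_
  · rw [noise_eq]
    exact h.sum_expected_descent hφ hW.mem_doublyStochastic hα.le N
  · rw [noise_eq]
    exact h.sum_expected_disagreement_le hφ hW hstep N

end IsNoisyTracking

end ExpectedProgress

/-! ### The stacked problem -/

section Problem

open scoped NNReal

/-- The gradients of the local objectives `f i`, each at the point of its own agent. -/
def gradStack {ι E : Type*} [NormedAddCommGroup E] [InnerProductSpace ℝ E] [CompleteSpace E]
    (f : ι → E → ℝ) (x : Stack ι E) : Stack ι E :=
  WithLp.toLp 2 fun i => gradient (f i) (x i)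

theorem lipschitzWith_gradStack {ι E : Type*} [Fintype ι] [NormedAddCommGroup E]
    [InnerProductSpace ℝ E] [CompleteSpace E] {f : ι → E → ℝ} {L : ℝ≥0}
    (hf : ∀ i, LipschitzWith L (gradient (f i))) : LipschitzWith L (gradStack f) := by
  refine LipschitzWith.of_dist_le_mul fun x y => (abs_le_of_sq_le_sq' ?_ (by positivity)).2
  simp only [dist_eq_norm, mul_pow, PiLp.norm_sq_eq_of_L2, Finset.mul_sum]
  refine Finset.sum_le_sum fun i _ => ?_
  rw [← mul_pow]
  exact pow_le_pow_left₀ (norm_nonneg _) ((hf i).norm_sub_le _ _) 2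

variable {n d : ℕ} {f : Fin n → Vec d → ℝ}

theorem mean_eq_avg (v : Stack (Fin n) (Vec d)) : mean v = avg fun i => v i := by
  simp only [mean_apply, Fintype.card_fin, avg]

theorem hasGradientAt_globalObj (hf : ∀ i, Differentiable ℝ (f i)) (x : Vec d) :
    HasGradientAt (globalObj f) (avg fun i => gradient (f i) x) x := by
  rw [hasGradientAt_iff_hasFDerivAt]
  have := (HasFDerivAt.fun_sum (u := Finset.univ) fun i _ =>
    hasGradientAt_iff_hasFDerivAt.1 (hf i x).hasGradientAt).const_mul ((n : ℝ)⁻¹)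
  refine this.congr_fderiv ?_
  simp [avg, map_sum]

theorem SmoothBelow.lipschitzWith_gradient {L : ℝ≥0} (h : SmoothBelow f L) (i : Fin n) :
    LipschitzWith L (gradient (f i)) :=
  LipschitzWith.of_dist_le_mul fun x y => by simpa only [dist_eq_norm] using h.lipschitz i x y

theorem SmoothBelow.isDistributedGradient {L : ℝ≥0} (h : SmoothBelow f L) :
    IsDistributedGradient (globalObj f) (gradStack f) L where
  lipschitzWith := lipschitzWith_gradStack h.lipschitzWith_gradient
  hasGradientAt y := by
    simpa only [mean_eq_avg, gradStack, replicate_apply]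
      using hasGradientAt_globalObj (fun i => (h.contDiff i).differentiable one_ne_zero) y
  bddBelow := h.bddBelow

theorem forty_eight_mul_sq_le_one {α L τ : ℝ} (hα : 0 < α) (hL : 0 < L) (hτ : 0 < τ)
    (hstep : α ≤ 1 / (4 * √3 * τ ^ 2 * L)) : 48 * (α * L * τ ^ 2) ^ 2 ≤ 1 := by
  rw [le_div_iff₀ (by positivity)] at hstep
  calc 48 * (α * L * τ ^ 2) ^ 2 = (α * (4 * √3 * τ ^ 2 * L)) ^ 2 := by
        linear_combination (-16 * α ^ 2 * L ^ 2 * τ ^ 4) * Real.sq_sqrt (zero_le_three (α := ℝ))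
    _ ≤ 1 := pow_le_one₀ (by positivity) hstep

end Problem

/-! ### Independence -/

section Independence

variable {Ω α β : Type*} {𝓗 𝒢 m₀ : MeasurableSpace Ω} {μ : Measure Ω} [MeasurableSpace α]
  [MeasurableSpace β]

theorem indepFun_prodMk_left [IsFiniteMeasure μ] {γ : Type*} [MeasurableSpace γ] {X : Ω → α}
    {Y : Ω → β} {Z : Ω → γ} (hX : Measurable X) (hY : Measurable Y) (hZ : Measurable Z)
    (h : IndepFun X (fun ω => (Y ω, Z ω)) μ) (hYZ : IndepFun Y Z μ) :
    IndepFun (fun ω => (X ω, Y ω)) Z μ := by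
  have hXY : IndepFun X Y μ := h.comp measurable_id measurable_fst
  rw [indepFun_iff_map_prod_eq_prod_map_map hX.aemeasurable hY.aemeasurable] at hXY
  rw [indepFun_iff_map_prod_eq_prod_map_map hY.aemeasurable hZ.aemeasurable] at hYZ
  rw [indepFun_iff_map_prod_eq_prod_map_map hX.aemeasurable (hY.prodMk hZ).aemeasurable, hYZ] at h
  rw [indepFun_iff_map_prod_eq_prod_map_map (hX.prodMk hY).aemeasurable hZ.aemeasurable, hXY]
  apply MeasurableEquiv.prodAssoc.map_measurableEquiv_injective
  rw [Measure.prodAssoc_prod, ← h,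
    Measure.map_map MeasurableEquiv.prodAssoc.measurable ((hX.prodMk hY).prodMk hZ)]
  rfl

variable [IsFiniteMeasure μ] {E : Type*} [NormedAddCommGroup E]
  {X : Ω → α} {V : Ω → β} {φ : α × β → E}

theorem integrable_prod_map_of_indepFun (hX : Measurable X) (hV : Measurable V)
    (hXV : IndepFun X V μ) (hφ : StronglyMeasurable φ)
    (hint : Integrable (fun ω => φ (X ω, V ω)) μ) : Integrable φ ((μ.map X).prod (μ.map V)) := by
  rw [← hXV.map_prod_eq_prod_map_map hX.aemeasurable hV.aemeasurable]
  exact (integrable_map_measure hφ.aestronglyMeasurable (hX.prodMk hV).aemeasurable).2 hint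

variable [NormedSpace ℝ E]

theorem setIntegral_preimage_eq_of_indepFun (hX : Measurable X) (hV : Measurable V)
    (hXV : IndepFun X V μ) (hφ : StronglyMeasurable φ)
    (hint : Integrable (fun ω => φ (X ω, V ω)) μ) {s : Set α} (hs : MeasurableSet s) :
    ∫ ω in X ⁻¹' s, φ (X ω, V ω) ∂μ = ∫ ω in X ⁻¹' s, ∫ z, φ (X ω, z) ∂(μ.map V) ∂μ := by
  have product := integrable_prod_map_of_indepFun hX hV hXV hφ hint
  calc ∫ ω in X ⁻¹' s, φ (X ω, V ω) ∂μ
      = ∫ q in s ×ˢ Set.univ, φ q ∂((μ.map X).prod (μ.map V)) := by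
        rw [← hXV.map_prod_eq_prod_map_map hX.aemeasurable hV.aemeasurable,
          setIntegral_map (hs.prod .univ) hφ.aestronglyMeasurable (hX.prodMk hV).aemeasurable,
          Set.mk_preimage_prod, Set.preimage_univ, Set.inter_univ]
    _ = ∫ a in s, ∫ z, φ (a, z) ∂(μ.map V) ∂(μ.map X) := by
        rw [setIntegral_prod φ product.integrableOn, Measure.restrict_univ]
    _ = _ := setIntegral_map hs hφ.integral_prod_right'.aestronglyMeasurable hX.aemeasurable

variable [CompleteSpace E]

theorem condExp_ae_eq_integral_of_indep (h𝒢 : 𝒢 ≤ m₀) (hX : Measurable[𝒢] X) (hV : Measurable V)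
    (hind : Indep 𝒢 (MeasurableSpace.comap V inferInstance) μ) (hφ : StronglyMeasurable φ)
    (hint : Integrable (fun ω => φ (X ω, V ω)) μ) :
    μ[fun ω => φ (X ω, V ω) | 𝒢] =ᵐ[μ] fun ω => ∫ z, φ (X ω, z) ∂(μ.map V) := by
  have indepFun {γ : Type _} [MeasurableSpace γ] {Y : Ω → γ} (hY : Measurable[𝒢] Y) :
      IndepFun Y V μ :=
    (IndepFun_iff_Indep _ _ _).2 (indep_of_indep_of_le_left hind hY.comap_le)
  have hXm : Measurable X := hX.mono h𝒢 le_rfl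
  have integrable_frozen : Integrable (fun ω => ∫ z, φ (X ω, z) ∂(μ.map V)) μ :=
    (integrable_prod_map_of_indepFun hXm hV (indepFun hX) hφ
      hint).integral_prod_left.comp_measurable hXm
  refine (ae_eq_condExp_of_forall_setIntegral_eq h𝒢 hint
    (fun s _ _ => integrable_frozen.integrableOn) (fun s hs _ => ?_)
    (hφ.integral_prod_right'.comp_measurable hX).aestronglyMeasurable).symm
  -- Recording the event `s` as a further coordinate of `X` keeps the pair independent of `V`.
  have hXs : Measurable[𝒢] fun ω => (X ω, ω ∈ s) := hX.prodMk (@MeasurableSet.mem _ s 𝒢 hs)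
  have := setIntegral_preimage_eq_of_indepFun (φ := fun q : (α × Prop) × β => φ (q.1.1, q.2))
    (hXs.mono h𝒢 le_rfl) hV (indepFun hXs)
    (hφ.comp_measurable (by fun_prop)) hint (s := Prod.snd ⁻¹' {True}) (by measurability)
  simpa using this.symm

theorem condExp_ae_eq_condExp_of_indep (h𝒢 : 𝒢 ≤ m₀) (h𝓗 : 𝓗 ≤ 𝒢)
    (hX : Measurable[𝓗] X) (hV : Measurable V)
    (hind : Indep 𝒢 (MeasurableSpace.comap V inferInstance) μ) (hφ : StronglyMeasurable φ)
    (hint : Integrable (fun ω => φ (X ω, V ω)) μ) :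
    μ[fun ω => φ (X ω, V ω) | 𝒢] =ᵐ[μ] μ[fun ω => φ (X ω, V ω) | 𝓗] :=
  (condExp_ae_eq_integral_of_indep h𝒢 (hX.mono h𝓗 le_rfl) hV hind hφ hint).trans
    (condExp_ae_eq_integral_of_indep (h𝓗.trans h𝒢) hX hV
      (indep_of_indep_of_le_left hind h𝓗) hφ hint).symm

end Independence

/-! ### The noise of GT-FT -/

section Samples

variable {n d : ℕ} {Ξ : Fin n → Type*} {Ω : Type*}

/-- The errors `∇F_i(x_i^(k); ξ_i^(k)) - ∇f_i(x_i^(k))` of all stochastic gradients at time `k`. -/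
def gradError (F : ∀ i, Vec d → Ξ i → ℝ) (f : Fin n → Vec d → ℝ) (ξ : ℕ → ∀ i, Ω → Ξ i)
    (x : ℕ → Ω → Fin n → Vec d) (k : ℕ) (ω : Ω) : Stack (Fin n) (Vec d) :=
  WithLp.toLp 2 fun i => stochGrad F i (x k ω i) (ξ k i ω) - gradient (f i) (x k ω i)

theorem mixL_toLp (W : Matrix (Fin n) (Fin n) ℝ) (v : Fin n → Vec d) :
    mixL W (WithLp.toLp 2 v : Stack (Fin n) (Vec d)) = WithLp.toLp 2 (mix W v) := by
  ext1 i
  exact mixL_apply W _ i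

theorem gradStack_add_gradError (F : ∀ i, Vec d → Ξ i → ℝ) (f : Fin n → Vec d → ℝ)
    (ξ : ℕ → ∀ i, Ω → Ξ i) (x : ℕ → Ω → Fin n → Vec d) (k : ℕ) (ω : Ω) :
    gradStack f (WithLp.toLp 2 (x k ω)) + gradError F f ξ x k ω
      = WithLp.toLp 2 fun i => stochGrad F i (x k ω i) (ξ k i ω) := by
  ext1 i
  exact add_sub_cancel _ _

theorem isTracking_state (F : ∀ i, Vec d → Ξ i → ℝ) (τ : ℕ) (W : ℕ → Matrix (Fin n) (Fin n) ℝ)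
    (α : ℝ) (x₀ : Fin n → Vec d) (z : ℕ → ∀ i, Ξ i) :
    IsTracking (fun k => mixL (W (k % τ))) α
      (fun k => (WithLp.toLp 2 (state F τ W α x₀ z k).1 : Stack (Fin n) (Vec d)))
      (fun k => WithLp.toLp 2 (state F τ W α x₀ z k).2)
      (fun k => WithLp.toLp 2 fun i => stochGrad F i ((state F τ W α x₀ z k).1 i) (z k i)) where
  param_succ k := by
    rw [← WithLp.toLp_smul, ← WithLp.toLp_sub, mixL_toLp]
    rfl
  tracker_zero := rfl
  tracker_succ k := by
    rw [mixL_toLp, ← WithLp.toLp_sub, ← WithLp.toLp_add]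
    congr 1
    funext i
    exact add_sub_assoc _ _ _

theorem measurable_mix [MeasurableSpace Ω] (W : Matrix (Fin n) (Fin n) ℝ)
    {v : Ω → Fin n → Vec d} (hv : Measurable v) : Measurable fun ω => mix W (v ω) := by
  unfold mix
  fun_prop

variable [∀ i, MeasurableSpace (Ξ i)] {F : ∀ i, Vec d → Ξ i → ℝ} {x₀ : Fin n → Ω → Vec d}
  {ξ : ℕ → ∀ i, Ω → Ξ i}

theorem measurable_stochGrad [MeasurableSpace Ω]
    (hF : ∀ i, Measurable fun p : Vec d × Ξ i => stochGrad F i p.1 p.2) {v : Ω → Fin n → Vec d}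
    (hv : Measurable v) {z : ∀ i, Ω → Ξ i} (hz : ∀ i, Measurable (z i)) :
    Measurable fun ω i => stochGrad F i (v ω i) (z i ω) :=
  measurable_pi_lambda _ fun i => (hF i).comp (((measurable_pi_apply i).comp hv).prodMk (hz i))

theorem measurable_state [MeasurableSpace Ω] (τ : ℕ) (W : ℕ → Matrix (Fin n) (Fin n) ℝ) (α : ℝ)
    (hF : ∀ i, Measurable fun p : Vec d × Ξ i => stochGrad F i p.1 p.2)
    (hx₀ : ∀ i, Measurable (x₀ i)) {k : ℕ} (hξ : ∀ l ≤ k, ∀ i, Measurable (ξ l i)) :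
    Measurable fun ω => state F τ W α (fun i => x₀ i ω) (fun l i => ξ l i ω) k := by
  induction k with
  | zero =>
    have hx₀ := measurable_pi_lambda (fun ω i => x₀ i ω) hx₀
    exact hx₀.prodMk (measurable_stochGrad hF hx₀ (hξ 0 le_rfl))
  | succ k ih =>
    have previous := ih fun l hl => hξ l (hl.trans k.le_succ)
    have param : Measurable fun ω =>
        (state F τ W α (fun i => x₀ i ω) (fun l i => ξ l i ω) (k + 1)).1 :=
      measurable_mix (W (k % τ)) (previous.fst.sub (previous.snd.const_smul α))
    exact param.prodMk (((measurable_mix (W (k % τ)) previous.snd).add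
      (measurable_stochGrad hF param (hξ (k + 1) le_rfl))).sub
      (measurable_stochGrad hF previous.fst (hξ k k.le_succ)))

theorem measurable_iter [MeasurableSpace Ω] (τ : ℕ) (W : ℕ → Matrix (Fin n) (Fin n) ℝ) (α : ℝ)
    (hF : ∀ i, Measurable fun p : Vec d × Ξ i => stochGrad F i p.1 p.2)
    (hx₀ : ∀ i, Measurable (x₀ i)) {k : ℕ} (hξ : ∀ l < k, ∀ i, Measurable (ξ l i)) :
    Measurable (iter F τ W α x₀ ξ k) := by
  cases k with
  | zero => exact measurable_pi_lambda _ hx₀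
  | succ k =>
    have previous := measurable_state τ W α hF hx₀ fun l hl => hξ l (Nat.lt_succ_of_le hl)
    exact measurable_mix (W (k % τ)) (previous.fst.sub (previous.snd.const_smul α))

/-- The initial points and the samples before time `k`. -/
def pastData (x₀ : Fin n → Ω → Vec d) (ξ : ℕ → ∀ i, Ω → Ξ i) (k : ℕ) (ω : Ω) :
    (Fin n → Vec d) × (Fin k → ∀ i, Ξ i) :=
  (fun i => x₀ i ω, fun l i => ξ l i ω)

theorem measurable_pastData [MeasurableSpace Ω] (hx₀ : ∀ i, Measurable (x₀ i)) {k : ℕ}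
    (hξ : ∀ l < k, ∀ i, Measurable (ξ l i)) : Measurable (pastData x₀ ξ k) :=
  (measurable_pi_lambda _ hx₀).prodMk (measurable_pi_lambda _ fun l =>
    measurable_pi_lambda _ (hξ l l.2))

theorem measurable_initial_comap_pastData (x₀ : Fin n → Ω → Vec d) (ξ : ℕ → ∀ i, Ω → Ξ i) (k : ℕ)
    (i : Fin n) : Measurable[MeasurableSpace.comap (pastData x₀ ξ k) inferInstance] (x₀ i) :=
  ((measurable_pi_apply i).comp measurable_fst).comp (comap_measurable (pastData x₀ ξ k))

theorem measurable_sample_comap_pastData (x₀ : Fin n → Ω → Vec d) (ξ : ℕ → ∀ i, Ω → Ξ i)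
    {k l : ℕ} (hl : l < k) (i : Fin n) :
    Measurable[MeasurableSpace.comap (pastData x₀ ξ k) inferInstance] (ξ l i) := by
  have eval : Measurable fun q : (Fin n → Vec d) × (Fin k → ∀ i, Ξ i) => q.2 ⟨l, hl⟩ i := by
    fun_prop
  exact eval.comp (comap_measurable (pastData x₀ ξ k))

variable {m₀ : MeasurableSpace Ω}

/-- The filtration generated by the initial points and the samples, those drawn at time `k` being
known from time `k + 1` on. -/
def pastFiltration (x₀ : Fin n → Ω → Vec d) (ξ : ℕ → ∀ i, Ω → Ξ i)
    (hx₀ : ∀ i, Measurable (x₀ i)) (hξ : ∀ l i, Measurable (ξ l i)) : Filtration ℕ m₀ where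
  seq k := MeasurableSpace.comap (pastData x₀ ξ k) inferInstance
  mono' k k' hkk' := Measurable.comap_le <|
    @measurable_pastData _ _ _ _ _ _ _ (MeasurableSpace.comap (pastData x₀ ξ k') inferInstance)
      (measurable_initial_comap_pastData x₀ ξ k') k
      fun _ hl => measurable_sample_comap_pastData x₀ ξ (hl.trans_le hkk')
  le' _ := (measurable_pastData hx₀ fun l _ => hξ l).comap_le

theorem indepFun_pastData {μ : Measure Ω} [IsFiniteMeasure μ] (h₀ : InitialCondition μ x₀ ξ)
    (hξ : ∀ l i, Measurable (ξ l i)) (hind : iIndepFun (fun p : ℕ × Fin n => ξ p.1 p.2) μ)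
    (k : ℕ) (i : Fin n) : IndepFun (pastData x₀ ξ k) (ξ k i) μ := by
  set past : Finset (ℕ × Fin n) := Finset.range k ×ˢ Finset.univ with past_def
  have mem_past (l : Fin k) (j : Fin n) : ((l : ℕ), j) ∈ past := by simp [past_def]
  have disjoint : Disjoint past {(k, i)} := by simp [past_def]
  have samples_indep : IndepFun (fun ω (l : Fin k) j => ξ l j ω) (ξ k i) μ :=
    (hind.indepFun_finset past {(k, i)} disjoint fun p => hξ p.1 p.2).comp
      (φ := fun (z : ∀ q : past, Ξ (q : ℕ × Fin n).2) (l : Fin k) j => z ⟨(l, j), mem_past l j⟩)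
      (ψ := fun z : ∀ q : ({(k, i)} : Finset (ℕ × Fin n)), Ξ (q : ℕ × Fin n).2 =>
        z ⟨(k, i), Finset.mem_singleton_self _⟩)
      (by fun_prop) (measurable_pi_apply _)
  have initial_indep := h₀.indep.comp (φ := id)
    (ψ := fun z : ∀ p : ℕ × Fin n, Ξ p.2 => (fun (l : Fin k) j => z (l, j), z (k, i)))
    measurable_id (by fun_prop)
  exact indepFun_prodMk_left (measurable_pi_lambda _ h₀.measurable)
    (by fun_prop) (hξ k i) initial_indep samples_indep

end Samples

section Noise

open scoped NNReal

variable {n d : ℕ} {Ξ : Fin n → Type*} {Ω : Type*} {𝓗 m₀ : MeasurableSpace Ω} {μ : Measure Ω}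
  {f : Fin n → Vec d → ℝ} {x : ℕ → Ω → Fin n → Vec d} {x₀ : Fin n → Ω → Vec d}

theorem measurable_history (x : ℕ → Ω → Fin n → Vec d) (k : ℕ) : Measurable[history x k] (x k) :=
  Measurable.of_comap_le <|
    le_iSup₂ (f := fun j (_ : j ∈ Set.Iic k) => MeasurableSpace.comap (x j) inferInstance) k
      (Set.mem_Iic.2 le_rfl)

theorem history_le {𝒢 : Filtration ℕ m₀} (hx : ∀ k, Measurable[𝒢 k] (x k)) (k : ℕ) :
    history x k ≤ 𝒢 k :=
  iSup₂_le fun j hj => ((hx j).mono (𝒢.mono hj) le_rfl).comap_le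

theorem condExp_ae_eq_zero_of_apply {X : Ω → Stack (Fin n) (Vec d)}
    (hX : Integrable X μ) (h : ∀ i, μ[fun ω => X ω i | 𝓗] =ᵐ[μ] 0) : μ[X | 𝓗] =ᵐ[μ] 0 := by
  have condExp_apply (i : Fin n) : (fun ω => (μ[X | 𝓗]) ω i) =ᵐ[μ] μ[fun ω => X ω i | 𝓗] :=
    (PiLp.proj 2 (fun _ : Fin n => Vec d) i :
      Stack (Fin n) (Vec d) →L[ℝ] Vec d).comp_condExp_comm hX
  filter_upwards [ae_all_iff.2 condExp_apply, ae_all_iff.2 h] with ω condExp_apply vanish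
  ext1 i
  exact (condExp_apply i).trans (vanish i)

variable [∀ i, MeasurableSpace (Ξ i)] {F : ∀ i, Vec d → Ξ i → ℝ} {ξ : ℕ → ∀ i, Ω → Ξ i}
  {L : ℝ≥0} {σ : ℝ}

theorem SmoothBelow.measurable_stochGrad_sub_gradient (hf : SmoothBelow f L)
    (hF : ∀ i, Measurable fun p : Vec d × Ξ i => stochGrad F i p.1 p.2) (i : Fin n) :
    Measurable fun p : (Fin n → Vec d) × Ξ i =>
      stochGrad F i (p.1 i) p.2 - gradient (f i) (p.1 i) := by
  have point : Measurable fun p : (Fin n → Vec d) × Ξ i => p.1 i := by fun_prop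
  exact ((hF i).comp (point.prodMk measurable_snd)).sub
    ((hf.lipschitzWith_gradient i).continuous.measurable.comp point)

namespace NoiseAssumption

variable {𝒢 : Filtration ℕ m₀}

theorem condExp_history_eq_zero [IsFiniteMeasure μ] (h : NoiseAssumption μ F f ξ x σ)
    (hf : SmoothBelow f L) {k : ℕ} (hk : history x k ≤ m₀) (i : Fin n) :
    μ[fun ω => stochGrad F i (x k ω i) (ξ k i ω) - gradient (f i) (x k ω i) | history x k]
      =ᵐ[μ] 0 := by
  have error_int := (h.sqIntegrable k i).integrable one_le_two
  have gradient_int : Integrable (fun ω => gradient (f i) (x k ω i)) μ :=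
    integrable_condExp.congr (h.unbiased k i)
  have stochGrad_int : Integrable (fun ω => stochGrad F i (x k ω i) (ξ k i ω)) μ := by
    simpa only [Pi.add_def, sub_add_cancel] using error_int.add gradient_int
  have gradient_known : StronglyMeasurable[history x k] fun ω => gradient (f i) (x k ω i) :=
    ((hf.lipschitzWith_gradient i).continuous.measurable.comp
      ((measurable_pi_apply i).comp (measurable_history x k))).stronglyMeasurable
  filter_upwards [condExp_sub stochGrad_int gradient_int (history x k), h.unbiased k i]
    with ω condExp_sub unbiased
  refine condExp_sub.trans ?_
  rw [Pi.sub_apply, unbiased, condExp_of_stronglyMeasurable hk gradient_known gradient_int]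
  exact sub_self _

theorem memLp_gradError (h : NoiseAssumption μ F f ξ x σ) (k : ℕ) :
    MemLp (gradError F f ξ x k) 2 μ :=
  MemLp.of_eval_piLp fun i => h.sqIntegrable k i

theorem stronglyMeasurable_gradError (hf : SmoothBelow f L)
    (hF : ∀ i, Measurable fun p : Vec d × Ξ i => stochGrad F i p.1 p.2) {k : ℕ}
    (hx : Measurable[𝓗] (x k)) (hξ : ∀ i, Measurable[𝓗] (ξ k i)) :
    StronglyMeasurable[𝓗] (gradError F f ξ x k) := by
  have error (i : Fin n) : Measurable[𝓗] fun ω =>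
      stochGrad F i (x k ω i) (ξ k i ω) - gradient (f i) (x k ω i) :=
    (hf.measurable_stochGrad_sub_gradient hF i).comp (f := fun ω => (x k ω, ξ k i ω))
      (hx.prodMk (hξ i))
  have stacked : Measurable[𝓗] (gradError F f ξ x k) :=
    (WithLp.measurable_toLp 2 _).comp (measurable_pi_lambda _ error)
  exact stacked.stronglyMeasurable

theorem condExp_error_eq_zero [IsFiniteMeasure μ] (h : NoiseAssumption μ F f ξ x σ)
    (hf : SmoothBelow f L) (hF : ∀ i, Measurable fun p : Vec d × Ξ i => stochGrad F i p.1 p.2)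
    (h𝓗 : 𝓗 ≤ m₀) {k : ℕ} (hk : history x k ≤ 𝓗) {i : Fin n}
    (hind : Indep 𝓗 (MeasurableSpace.comap (ξ k i) inferInstance) μ) :
    μ[fun ω => stochGrad F i (x k ω i) (ξ k i ω) - gradient (f i) (x k ω i) | 𝓗] =ᵐ[μ] 0 :=
  (condExp_ae_eq_condExp_of_indep
    (φ := fun p : (Fin n → Vec d) × Ξ i => stochGrad F i (p.1 i) p.2 - gradient (f i) (p.1 i))
    h𝓗 hk (measurable_history x k) (h.measurable k i) hind
    (hf.measurable_stochGrad_sub_gradient hF i).stronglyMeasurable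
    ((h.sqIntegrable k i).integrable one_le_two)).trans
    (h.condExp_history_eq_zero hf (hk.trans h𝓗) i)

theorem isMartingaleDifference [IsFiniteMeasure μ] (h : NoiseAssumption μ F f ξ x σ)
    (hf : SmoothBelow f L) (hF : ∀ i, Measurable fun p : Vec d × Ξ i => stochGrad F i p.1 p.2)
    (hx : ∀ k, Measurable[𝒢 k] (x k)) (hξ : ∀ k i, Measurable[𝒢 (k + 1)] (ξ k i))
    (hind : ∀ k i, Indep (𝒢 k) (MeasurableSpace.comap (ξ k i) inferInstance) μ) :
    IsMartingaleDifference μ 𝒢 (gradError F f ξ x) where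
  memLp := h.memLp_gradError
  stronglyMeasurable k :=
    stronglyMeasurable_gradError hf hF ((hx k).mono (𝒢.mono k.le_succ) le_rfl) (hξ k)
  condExp_eq_zero k :=
    condExp_ae_eq_zero_of_apply ((h.memLp_gradError k).integrable one_le_two) fun i =>
      h.condExp_error_eq_zero hf hF (𝒢.le k) (history_le hx k) (hind k i)

theorem integral_gradError_sq_le [IsProbabilityMeasure μ] (h : NoiseAssumption μ F f ξ x σ)
    {k : ℕ} (hk : history x k ≤ m₀) :
    ∫ ω, ‖gradError F f ξ x k ω‖ ^ 2 ∂μ ≤ Fintype.card (Fin n) * σ ^ 2 := by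
  have agent_bound (i : Fin n) :
      ∫ ω, ‖stochGrad F i (x k ω i) (ξ k i ω) - gradient (f i) (x k ω i)‖ ^ 2 ∂μ ≤ σ ^ 2 := by
    rw [← integral_condExp hk]
    simpa using integral_mono_ae integrable_condExp (integrable_const (σ ^ 2)) (h.variance k i)
  calc ∫ ω, ‖gradError F f ξ x k ω‖ ^ 2 ∂μ
      = ∑ i, ∫ ω, ‖stochGrad F i (x k ω i) (ξ k i ω) - gradient (f i) (x k ω i)‖ ^ 2 ∂μ := by
        rw [← integral_finsetSum _ fun i _ => (h.sqIntegrable k i).norm.integrable_sq]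
        exact integral_congr_ae (.of_forall fun ω => PiLp.norm_sq_eq_of_L2 _ _)
    _ ≤ ∑ _i : Fin n, σ ^ 2 := Finset.sum_le_sum fun i _ => agent_bound i
    _ = Fintype.card (Fin n) * σ ^ 2 := by
        rw [Finset.sum_const, Finset.card_univ, nsmul_eq_mul]

theorem isNoisyTracking [IsProbabilityMeasure μ] {τ : ℕ} {W : ℕ → Matrix (Fin n) (Fin n) ℝ}
    {α : ℝ} (h : NoiseAssumption μ F f ξ (iter F τ W α x₀ ξ) σ) (h₀ : InitialCondition μ x₀ ξ)
    (hf : SmoothBelow f L)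
    (hF : ∀ i, Measurable fun p : Vec d × Ξ i => stochGrad F i p.1 p.2) :
    IsNoisyTracking μ (pastFiltration x₀ ξ h₀.measurable h.measurable) (fun k => W (k % τ)) α
      (σ ^ 2) (gradStack f) (fun k ω => WithLp.toLp 2 (iter F τ W α x₀ ξ k ω))
      (fun k ω => WithLp.toLp 2 (state F τ W α (fun i => x₀ i ω) (fun l i => ξ l i ω) k).2)
      (gradError F f ξ (iter F τ W α x₀ ξ)) := by
  set 𝒢 := pastFiltration x₀ ξ h₀.measurable h.measurable
  have iter_known (k : ℕ) : Measurable[𝒢 k] (iter F τ W α x₀ ξ k) :=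
    @measurable_iter _ _ _ _ _ _ _ _ (𝒢 k) τ W α hF (measurable_initial_comap_pastData x₀ ξ k) k
      fun _ hl => measurable_sample_comap_pastData x₀ ξ hl
  exact
    { isTracking := fun ω => by
        simp only [gradStack_add_gradError]
        exact isTracking_state F τ W α (fun i => x₀ i ω) fun l i => ξ l i ω
      memLp_zero := MemLp.of_eval_piLp h₀.memLp
      stronglyMeasurable := fun k =>
        ((WithLp.measurable_toLp 2 _).comp (iter_known k)).stronglyMeasurable
      noise := h.isMartingaleDifference hf hF iter_known
        (fun k i => measurable_sample_comap_pastData x₀ ξ k.lt_succ_self i)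
        fun k i => (IndepFun_iff_Indep _ _ _).1 (indepFun_pastData h₀ h.measurable h.indep k i)
      integral_noise_sq_le := fun k =>
        h.integral_gradError_sq_le ((history_le iter_known k).trans (𝒢.le k)) }

end NoiseAssumption

end Noise

/-! ### The quantities in the rate -/

section Rate

open scoped NNReal

variable {n d : ℕ} {Ω : Type*} {m₀ : MeasurableSpace Ω} {μ : Measure Ω} {f : Fin n → Vec d → ℝ}
  {L : ℝ≥0}

theorem inv_card_mul_integral_norm_center_sq {X : Ω → Stack (Fin n) (Vec d)} (hX : MemLp X 2 μ) :
    (Fintype.card (Fin n) : ℝ)⁻¹ * ∫ ω, ‖center (X ω)‖ ^ 2 ∂μ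
      = (n : ℝ)⁻¹ * ∑ i, ∫ ω, ‖X ω i - avg fun j => X ω j‖ ^ 2 ∂μ := by
  have center_apply (ω : Ω) (i : Fin n) : center (X ω) i = X ω i - avg fun j => X ω j := by
    rw [center_apply, PiLp.sub_apply, replicate_apply, mean_eq_avg]
  have memLp_apply (i : Fin n) : MemLp (fun ω => center (X ω) i) 2 μ :=
    (PiLp.proj 2 (fun _ : Fin n => Vec d) i : Stack (Fin n) (Vec d) →L[ℝ] Vec d).comp_memLp'
      (memLp_center hX)
  simp only [← center_apply]
  rw [Fintype.card_fin, ← integral_finsetSum _ fun i _ => (memLp_apply i).norm.integrable_sq]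
  congr 2 with ω
  exact PiLp.norm_sq_eq_of_L2 _ _

theorem stationarity_toLp (v : Fin n → Vec d) :
    stationarity (globalObj f) (gradStack f) (WithLp.toLp 2 v)
      = ‖avg fun i => gradient (f i) (v i)‖ ^ 2 + ‖gradient (globalObj f) (avg v)‖ ^ 2 := by
  rw [stationarity, mean_eq_avg, mean_eq_avg]
  rfl

namespace SmoothBelow

variable [IsFiniteMeasure μ] {x : Ω → Fin n → Vec d}

theorem integrable_norm_avg_gradient_sq (hf : SmoothBelow f L)
    (hx : MemLp (fun ω => (WithLp.toLp 2 (x ω) : Stack (Fin n) (Vec d))) 2 μ) :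
    Integrable (fun ω => ‖avg fun i => gradient (f i) (x ω i)‖ ^ 2) μ := by
  have gradient_memLp := memLp_mean (memLp_comp_of_lipschitzWith
    hf.isDistributedGradient.lipschitzWith hx)
  simp only [mean_eq_avg] at gradient_memLp
  exact gradient_memLp.norm.integrable_sq

theorem integrable_norm_gradient_avg_sq [NeZero n] (hf : SmoothBelow f L)
    (hx : MemLp (fun ω => (WithLp.toLp 2 (x ω) : Stack (Fin n) (Vec d))) 2 μ) :
    Integrable (fun ω => ‖gradient (globalObj f) (avg (x ω))‖ ^ 2) μ := by
  have gradient_memLp := memLp_comp_of_lipschitzWith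
    hf.isDistributedGradient.lipschitzWith_gradient (memLp_mean hx)
  simp only [mean_eq_avg] at gradient_memLp
  exact gradient_memLp.norm.integrable_sq

end SmoothBelow

theorem NoiseAssumption.sum_integral_stationarity_le [NeZero n] {Ξ : Fin n → Type*}
    [∀ i, MeasurableSpace (Ξ i)] [IsProbabilityMeasure μ] {F : ∀ i, Vec d → Ξ i → ℝ}
    {x₀ : Fin n → Ω → Vec d} {ξ : ℕ → ∀ i, Ω → Ξ i} {τ : ℕ} {W : ℕ → Matrix (Fin n) (Fin n) ℝ}
    {α σ : ℝ} (h : NoiseAssumption μ F f ξ (iter F τ W α x₀ ξ) σ) (h₀ : InitialCondition μ x₀ ξ)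
    (hf : SmoothBelow f L) (hF : ∀ i, Measurable fun p : Vec d × Ξ i => stochGrad F i p.1 p.2)
    (hW : FiniteTimeConsensus τ W) (hα : 0 < α) (hstep : 48 * (α * L * τ ^ 2) ^ 2 ≤ 1) (N : ℕ) :
    ∑ k ∈ Finset.range N, ∫ ω, stationarity (globalObj f) (gradStack f)
        (WithLp.toLp 2 (iter F τ W α x₀ ξ k ω)) ∂μ
      ≤ 48 * (initialGap μ f x₀ / α + L ^ 2 * (τ * initialDisagreement μ x₀
          + α ^ 2 * τ ^ 3 * initialGradSpread μ f x₀)) + 18 * (N * σ ^ 2 / τ) := by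
  have tracking := h.isNoisyTracking h₀ hf hF
  have bound := tracking.sum_integral_stationarity_le hf.isDistributedGradient
    hW.periodicConsensus hα hstep N
  rw [inv_card_mul_integral_norm_center_sq tracking.memLp_zero,
    inv_card_mul_integral_norm_center_sq
      (memLp_comp_of_lipschitzWith hf.isDistributedGradient.lipschitzWith tracking.memLp_zero)]
    at bound
  simp only [mean_eq_avg] at bound
  exact bound

end Rate

end GTFT

end

theorem mainTheorem1_general {n d τ : ℕ} {L σ α : ℝ} (hn : 0 < n) (hL : 0 < L) (hα : 0 < α)
    (hstep : α ≤ 1 / (4 * √3 * (τ : ℝ) ^ 2 * L))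
    {Ξ : Fin n → Type*} [∀ i, MeasurableSpace (Ξ i)]
    {F : ∀ i, GTFT.Vec d → Ξ i → ℝ} {f : Fin n → GTFT.Vec d → ℝ}
    (_ : ∀ i z, Differentiable ℝ fun y => F i y z)
    (hF : ∀ i, Measurable fun p : GTFT.Vec d × Ξ i => GTFT.stochGrad F i p.1 p.2)
    (hf : GTFT.SmoothBelow f L)
    {W : ℕ → Matrix (Fin n) (Fin n) ℝ} (hW : GTFT.FiniteTimeConsensus τ W)
    {Ω : Type*} [MeasurableSpace Ω] {μ : Measure Ω} [IsProbabilityMeasure μ]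
    {x₀ : Fin n → Ω → GTFT.Vec d} {ξ : ℕ → ∀ i, Ω → Ξ i} {x : ℕ → Ω → Fin n → GTFT.Vec d}
    (hx : x = GTFT.iter F τ W α x₀ ξ) (h₀ : GTFT.InitialCondition μ x₀ ξ)
    (hξ : GTFT.NoiseAssumption μ F f ξ x σ) :
    (∀ k,
      Integrable (fun ω => ‖GTFT.avg fun i => gradient (f i) (x k ω i)‖ ^ 2) μ ∧
      Integrable (fun ω => ‖gradient (GTFT.globalObj f) (GTFT.avg (x k ω))‖ ^ 2) μ) ∧
    ∀ T : ℕ,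
      1 / ((T : ℝ) + 1) * ∑ k ∈ Finset.range (T + 1),
          ((∫ ω, ‖GTFT.avg fun i => gradient (f i) (x k ω i)‖ ^ 2 ∂μ)
            + ∫ ω, ‖gradient (GTFT.globalObj f) (GTFT.avg (x k ω))‖ ^ 2 ∂μ)
        ≤ 48 * (GTFT.initialGap μ f x₀ / (α * (τ : ℝ) ^ 2 * L ^ 2)
            + GTFT.initialDisagreement μ x₀ / τ
            + α ^ 2 * τ * GTFT.initialGradSpread μ f x₀) * (τ : ℝ) ^ 2 * L ^ 2 / (T + 1)
          + 18 * σ ^ 2 / τ := by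
  subst hx
  lift L to NNReal using hL.le
  have : NeZero n := ⟨hn.ne'⟩
  have hτ : (0 : ℝ) < τ := by exact_mod_cast hW.one_le
  have iterates_memLp (k : ℕ) := (hξ.isNoisyTracking h₀ hf hF).memLp_param
    hf.isDistributedGradient k
  have avg_gradient_int (k : ℕ) := hf.integrable_norm_avg_gradient_sq (iterates_memLp k)
  have gradient_avg_int (k : ℕ) := hf.integrable_norm_gradient_avg_sq (iterates_memLp k)
  refine ⟨fun k => ⟨avg_gradient_int k, gradient_avg_int k⟩, fun T => ?_⟩
  have bound := hξ.sum_integral_stationarity_le h₀ hf hF hW hα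
    (GTFT.forty_eight_mul_sq_le_one hα hL hτ hstep) (T + 1)
  simp only [GTFT.stationarity_toLp] at bound
  simp only [integral_add (avg_gradient_int _) (gradient_avg_int _)] at bound
  refine (mul_le_mul_of_nonneg_left bound (by positivity)).trans_eq ?_
  push_cast
  field_simp
  ring

theorem mainTheorem1 :
    -- absolute constants
    ∃ c γ₂ γ₃ : ℝ, 0 < c ∧ 0 < γ₂ ∧ 0 < γ₃ ∧
    ∀ (n d τ : ℕ) (L σ α : ℝ), 0 < n → 0 < L → 0 < σ →
    0 < α → α ≤ 1 / (4 * √3 * (τ : ℝ) ^ 2 * L) →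
    -- the problem, given by the loss functions and the data distributions
    ∀ (Ξ : Fin n → Type*) [∀ i, MeasurableSpace (Ξ i)]
      (P : ∀ i, Measure (Ξ i)) [∀ i, IsProbabilityMeasure (P i)]
      (F : ∀ i, GTFT.Vec d → Ξ i → ℝ) (f : Fin n → GTFT.Vec d → ℝ),
    f = GTFT.localObj P F →
    GTFT.LossRegular P F →
    GTFT.SmoothBelow f L →
    -- the mixing matrices
    ∀ (W : ℕ → Matrix (Fin n) (Fin n) ℝ), GTFT.FiniteTimeConsensus τ W →
    -- the initial points, the samples and the iterates
    ∀ (Ω : Type*) [MeasurableSpace Ω] (μ : Measure Ω) [IsProbabilityMeasure μ]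
      (x₀ : Fin n → Ω → GTFT.Vec d) (ξ : ℕ → ∀ i, Ω → Ξ i)
      (x : ℕ → Ω → Fin n → GTFT.Vec d),
    x = GTFT.iter F τ W α x₀ ξ →
    GTFT.InitialCondition μ x₀ ξ →
    GTFT.NoiseAssumption μ F f ξ x σ →
    -- the expectations below are those of integrable random variables
    (∀ k,
      Integrable (fun ω => ‖GTFT.avg fun i => gradient (f i) (x k ω i)‖ ^ 2) μ ∧
      Integrable (fun ω => ‖gradient (GTFT.globalObj f) (GTFT.avg (x k ω))‖ ^ 2) μ) ∧
    -- the rate: `γ₁` depends only on the initial data, `L`, `τ` and `α`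
    ∀ γ₁ : ℝ, 0 < γ₁ →
      c * (GTFT.initialGap μ f x₀ / (α * (τ : ℝ) ^ 2 * L ^ 2)
          + GTFT.initialDisagreement μ x₀ / τ
          + α ^ 2 * τ * GTFT.initialGradSpread μ f x₀) ≤ γ₁ →
      ∀ T : ℕ, τ ≤ T →
        1 / ((T : ℝ) + 1) * ∑ k ∈ Finset.range (T + 1),
          ((∫ ω, ‖GTFT.avg fun i => gradient (f i) (x k ω i)‖ ^ 2 ∂μ)
            + ∫ ω, ‖gradient (GTFT.globalObj f) (GTFT.avg (x k ω))‖ ^ 2 ∂μ)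
        ≤ γ₁ * (τ : ℝ) ^ 2 * L ^ 2 / T + γ₂ * σ ^ 2 / τ + γ₃ * σ ^ 2 / ((τ : ℝ) ^ 2 * n) := by
  refine ⟨48, 18, 1, by norm_num, by norm_num, one_pos, ?_⟩
  intro n d τ L σ α hn hL _ hα hstep Ξ _ P _ F f _ hF hf W hW Ω _ μ _ x₀ ξ x hx h₀ hξ
  obtain ⟨integrable, rate⟩ := mainTheorem1_general hn hL hα hstep hF.differentiable
    hF.measurable_grad hf hW hx h₀ hξ
  refine ⟨integrable, fun γ₁ hγ₁ initial_le T hT => (rate T).trans ?_⟩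
  have T_pos : (0 : ℝ) < T := by exact_mod_cast hW.one_le.trans hT
  calc _ ≤ γ₁ * (τ : ℝ) ^ 2 * L ^ 2 / T + 18 * σ ^ 2 / τ := by
        gcongr
        exact (lt_add_one (T : ℝ)).le
    _ ≤ _ := le_add_of_nonneg_right (by positivity)
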